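/- Let $T>0$ and let $U:\mathbb R\times\mathbb R^2\to\mathbb R$ be of class $C^1$, $T$-periodic in its first variable, and such that, for some $C>0$ and $\alpha\in(0,2)$, $|U(t,x)|\le C(1+|x|^\alpha)$ for all $(t,x)\in\mathbb R\times\mathbb R^2$. Let $H^1_T$ be the space of $H^1$ functions $x:[0,T]\to\mathbb R^2$ (identified with their continuous representatives) such that $x(0)=x(T)$. Let $\mathcal X_c$ be the set of $x\in H^1_T$ such that $x(t_0)=0$ for some $t_0\in[0,T]$, let $\mathcal X_r$ be the set of $x\in H^1_T$ that never vanish on $[0,T]$ and have nonzero winding number around the origin, and put $\mathcal X=\mathcal X_c\cup\mathcal X_r$. For $x\in\mathcal X$ let $$A_T(x)=\int_0^T\Big(\tfrac12|\dot x(t)|^2+\frac1{|x(t)|}+U(t,x(t))\Big)\,dt\in(-\infty,+\infty].$$ Let $x\in\mathcal X_c$ be a minimizer of $A_T$ on $\mathcal X$, and let $E_x=\{t\in[0,T]:x(t)=0\}$. Then $E_x$ has Lebesgue measure zero and $x$ is differentiable at every point of $[0,T]\setminus E_x$ (one-sidedly at $0$ and $T$), so that the energy $$h_x(t)=\tfrac12|\dot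 x(t)|^2-\frac1{|x(t)|},\qquad t\in[0,T]\setminus E_x,$$ is well defined. Moreover, $h_x\in W^{1,1}(0,T)$, its distributional derivative on $(0,T)$ is $\dot h_x(t)=\langle\nabla_xU(t,x(t)),\dot x(t)\rangle$, and there is a continuous function on $[0,T]$ that coincides with $h_x$ at every point of $[0,T]\setminus E_x$. -/

import Mathlib

open MeasureTheory Set
open scoped ENNReal ContDiff

noncomputable section

namespace ForcedKepler

/-- The Euclidean plane. -/
abbrev Plane : Type := EuclideanSpace ℝ (Fin 2)

/-- `φ ∈ C_c^∞((0,T))`. -/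
def IsTestFunction (T : ℝ) (φ : ℝ → ℝ) : Prop :=
  ContDiff ℝ ∞ φ ∧ HasCompactSupport φ ∧ tsupport φ ⊆ Ioo 0 T

/-- `g` is the distributional derivative of `f` on the open interval `(0,T)`. -/
def HasWeakDeriv {F : Type*} [NormedAddCommGroup F] [NormedSpace ℝ F]
    (T : ℝ) (f g : ℝ → F) : Prop :=
  LocallyIntegrableOn f (Ioo 0 T) ∧ LocallyIntegrableOn g (Ioo 0 T) ∧
    ∀ φ : ℝ → ℝ, IsTestFunction T φ →
      ∫ t in Ioo 0 T, deriv φ t • f t = - ∫ t in Ioo 0 T, φ t • g t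

/-- `f ∈ W^{1,p}(0,T)`: both `f` and some distributional derivative of `f` are in `L^p(0,T)`. -/
def MemSobolev {F : Type*} [NormedAddCommGroup F] [NormedSpace ℝ F]
    (T : ℝ) (p : ℝ≥0∞) (f : ℝ → F) : Prop :=
  MemLp f p (volume.restrict (Ioo 0 T)) ∧
    ∃ g : ℝ → F, MemLp g p (volume.restrict (Ioo 0 T)) ∧ HasWeakDeriv T f g

/-- The space `H^1_T` of `H^1` loops; as usual an `H^1` function on `[0,T]` is represented
by its continuous representative. Only the values of `x` on `[0,T]` are relevant. -/
def HOneLoops (T : ℝ) : Set (ℝ → Plane) :=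
  {x | ContinuousOn x (Icc 0 T) ∧ MemSobolev T 2 x ∧ x 0 = x T}

/-- `r` is the winding number around the origin of the path `x : [0,T] → ℝ² \ {0}`: in
continuous polar coordinates, `r = (θ(T) - θ(0)) / (2π)`. (Such coordinates always exist,
and `r` does not depend on their choice.) -/
def HasWindingNumber (T : ℝ) (x : ℝ → Plane) (r : ℝ) : Prop :=
  ∃ ρ θ : ℝ → ℝ, ContinuousOn ρ (Icc 0 T) ∧ ContinuousOn θ (Icc 0 T) ∧
    (∀ t ∈ Icc 0 T, 0 < ρ t ∧ x t = !₂[ρ t * Real.cos (θ t), ρ t * Real.sin (θ t)]) ∧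
    r = (θ T - θ 0) / (2 * Real.pi)

/-- The loops with a collision. -/
def collisionLoops (T : ℝ) : Set (ℝ → Plane) :=
  {x | x ∈ HOneLoops T ∧ ∃ t₀ ∈ Icc 0 T, x t₀ = 0}

/-- The collision-free loops with nonzero winding number around the origin. -/
def rotatingLoops (T : ℝ) : Set (ℝ → Plane) :=
  {x | x ∈ HOneLoops T ∧ (∀ t ∈ Icc 0 T, x t ≠ 0) ∧ ∃ r : ℝ, HasWindingNumber T x r ∧ r ≠ 0}

/-- The class on which the action is minimized. -/
def admissibleLoops (T : ℝ) : Set (ℝ → Plane) :=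
  collisionLoops T ∪ rotatingLoops T

/-- The velocity `ẋ(t)`, `t ∈ [0,T]` (one-sided derivatives at the endpoints). An `H^1` function
is absolutely continuous, so this derivative exists at almost every `t`, and it is almost
everywhere equal to the weak derivative. -/
def velocity (T : ℝ) (x : ℝ → Plane) (t : ℝ) : Plane :=
  derivWithin x (Icc 0 T) t

/-- The action `∫₀ᵀ (|ẋ|²/2 + 1/|x| + U(t,x)) dt`, with values in `(-∞, +∞]`. The first two terms
are nonnegative and are integrated as `[0,∞]`-valued functions, with `1/|0| = ∞`;
the last one is continuous on `[0,T]` for continuous `U` and `x`. -/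
def action (T : ℝ) (U : ℝ → Plane → ℝ) (x : ℝ → Plane) : EReal :=
  ((∫⁻ t in Icc 0 T, (‖velocity T x t‖ₑ ^ 2 / 2 + ‖x t‖ₑ⁻¹) : ℝ≥0∞) : EReal) +
    ((∫ t in Icc 0 T, U t (x t) : ℝ) : EReal)

/-- The energy `h_x(t) = |ẋ(t)|²/2 - 1/|x(t)|`, meaningful where `x(t) ≠ 0`. -/
def energy (T : ℝ) (x : ℝ → Plane) (t : ℝ) : ℝ :=
  ‖velocity T x t‖ ^ 2 / 2 - 1 / ‖x t‖

end ForcedKepler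

end

/-! Comparison with one turn of the unit circle shows that the minimizer has finite action. Both
terms of the action with values in `[0,∞]` are therefore integrable, so `1/|x|` is integrable and
collisions fill only a null set. The rest comes from two families of variations, both of which keep
a collision and hence stay admissible.

Inner variations move time: with `σ(s) = s + ε φ(s)`, the loop `x ∘ σ⁻¹` still passes through the
origin. After the change of variables the kinetic term is divided by `σ'` and the other terms are
multiplied by it, so the action is differentiable at `ε = 0` even when the support of `φ` contains
collisions. Stationarity reads `∫ φ' h = ∫ (φ' U + φ ∂ₜU)`. Since `t ↦ U(t, x(t))` is absolutely
continuous, integration by parts turns the right side into `-∫ φ ⟨∇U, ẋ⟩`. This is the weak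
derivative of the energy `h` on the whole interval (`integral_inner_variation_eq_zero`,
`hasWeakDeriv_energy`). By du Bois-Reymond, `h` is then a.e. equal to a continuous primitive `H`
(`exists_ae_eq_add_integral`).

Outer variations `x + ε φ e`, with `φ` supported away from collisions, give the weak Newton equation
there. So `ẋ` is a.e. a primitive of the continuous force, and `x` is `C¹` near every collision-free
time, endpoints included (`exists_Icc_hasDerivWithinAt`). Near such a time `h` is continuous and
a.e. equal to `H`, hence equal to `H` everywhere. -/

namespace ForcedKepler

variable {F : Type*} [NormedAddCommGroup F] [NormedSpace ℝ F]

/-! ### Absolutely continuous functions -/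

open Filter in
/-- A function whose increments are dominated by those of an absolutely continuous function is
absolutely continuous. -/
theorem absolutelyContinuousOnInterval_of_dist_le {X Y : Type*} [PseudoMetricSpace X]
    [PseudoMetricSpace Y] {f : ℝ → X} {m : ℝ → Y} {a b : ℝ}
    (hm : AbsolutelyContinuousOnInterval m a b)
    (h : ∀ s ∈ uIcc a b, ∀ t ∈ uIcc a b, dist (f s) (f t) ≤ dist (m s) (m t)) :
    AbsolutelyContinuousOnInterval f a b := by
  rw [absolutelyContinuousOnInterval_iff] at hm ⊢
  intro ε hε
  obtain ⟨δ, hδ, H⟩ := hm ε hε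
  refine ⟨δ, hδ, fun E hE hl => lt_of_le_of_lt (Finset.sum_le_sum fun i hi => ?_) (H E hE hl)⟩
  have := hE.1 i hi
  exact h _ this.1 _ this.2

/-- `f` is, on `[a, b]`, a primitive of the integrable function `g`. -/
structure IsPrimitive (a b : ℝ) (f g : ℝ → F) : Prop where
  integrable : IntervalIntegrable g volume a b
  eq_add : ∀ t ∈ Icc a b, f t = f a + ∫ s in a..t, g s

namespace IsPrimitive

variable {a b : ℝ} {f g : ℝ → F}

theorem intervalIntegrable (h : IsPrimitive a b f g) {s t : ℝ} (hs : s ∈ Icc a b)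
    (ht : t ∈ Icc a b) : IntervalIntegrable g volume s t :=
  h.integrable.mono_set (by
    rw [uIcc_of_le (hs.1.trans hs.2)]
    exact uIcc_subset_Icc hs ht)

theorem sub_eq (h : IsPrimitive a b f g) {s t : ℝ} (hs : s ∈ Icc a b) (ht : t ∈ Icc a b) :
    f t - f s = ∫ r in s..t, g r := by
  have ha : a ∈ Icc a b := ⟨le_rfl, hs.1.trans hs.2⟩
  rw [h.eq_add t ht, h.eq_add s hs, add_sub_add_left_eq_sub,
    intervalIntegral.integral_interval_sub_left (h.intervalIntegrable ha ht)
      (h.intervalIntegrable ha hs)]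

theorem mono (h : IsPrimitive a b f g) {c d : ℝ} (hc : c ∈ Icc a b) (hd : d ∈ Icc a b) :
    IsPrimitive c d f g := by
  refine ⟨h.intervalIntegrable hc hd, fun t ht => ?_⟩
  rw [← h.sub_eq hc ⟨hc.1.trans ht.1, ht.2.trans hd.2⟩]
  abel

theorem norm_sub_le (h : IsPrimitive a b f g) {s t : ℝ} (hs : s ∈ Icc a b) (ht : t ∈ Icc a b) :
    ‖f t - f s‖ ≤ |(∫ r in a..t, ‖g r‖) - ∫ r in a..s, ‖g r‖| := by
  have ha : a ∈ Icc a b := ⟨le_rfl, hs.1.trans hs.2⟩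
  rw [h.sub_eq hs ht, intervalIntegral.integral_interval_sub_left
    (h.intervalIntegrable ha ht).norm (h.intervalIntegrable ha hs).norm]
  exact intervalIntegral.norm_integral_le_abs_integral_norm

theorem absolutelyContinuous (hab : a ≤ b) (h : IsPrimitive a b f g) :
    AbsolutelyContinuousOnInterval f a b := by
  refine absolutelyContinuousOnInterval_of_dist_le
    (h.integrable.norm.absolutelyContinuousOnInterval_intervalIntegral (c := a) (by simp)) ?_
  rw [uIcc_of_le hab]
  intro s hs t ht
  rw [dist_eq_norm, Real.dist_eq]
  exact h.norm_sub_le ht hs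

theorem continuousOn (hab : a ≤ b) (h : IsPrimitive a b f g) : ContinuousOn f (Icc a b) := by
  have := (h.absolutelyContinuous hab).continuousOn
  rwa [uIcc_of_le hab] at this

theorem ae_hasDerivAt [CompleteSpace F] (hab : a ≤ b) (h : IsPrimitive a b f g) :
    ∀ᵐ t, t ∈ Icc a b → HasDerivAt f (g t) t := by
  -- The endpoints are discarded because `f` agrees with the primitive only on `[a, b]`, which is
  -- not a neighbourhood of them.
  have h₁ : ∀ᵐ x : ℝ, x ≠ a := by simp [ae_iff, measure_singleton]
  have h₂ : ∀ᵐ x : ℝ, x ≠ b := by simp [ae_iff, measure_singleton]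
  filter_upwards [h.integrable.ae_hasDerivAt_integral, h₁, h₂] with t ht h1 h2 hm
  rw [uIcc_of_le hab] at ht
  have := (ht hm a ⟨le_rfl, hab⟩).const_add (f a)
  refine this.congr_of_eventuallyEq ?_
  filter_upwards [Icc_mem_nhds (lt_of_le_of_ne hm.1 h1.symm) (lt_of_le_of_ne hm.2 h2)] with s hs
  exact h.eq_add s hs

/-- An absolutely continuous function is the primitive of its derivative. -/
theorem of_ae_hasDerivAt [CompleteSpace F] (hab : a ≤ b)
    (hf : AbsolutelyContinuousOnInterval f a b) (hg : IntervalIntegrable g volume a b)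
    (h : ∀ᵐ t, t ∈ Icc a b → HasDerivAt f (g t) t) : IsPrimitive a b f g := by
  have hG : IsPrimitive a b (fun t => ∫ s in a..t, g s) g := ⟨hg, by simp⟩
  -- The difference of `f` and `∫ g` is absolutely continuous with derivative zero a.e., hence
  -- constant.
  obtain ⟨C, hC⟩ := (hf.fun_sub (hG.absolutelyContinuous hab)).const_of_ae_hasDerivAt_zero (by
    filter_upwards [h, hG.ae_hasDerivAt hab] with t h1 h2 ht
    rw [uIcc_of_le hab] at ht
    simpa using (h1 ht).fun_sub (h2 ht))
  rw [uIcc_of_le hab] at hC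
  refine ⟨hg, fun t ht => ?_⟩
  have h1 := hC t ht
  have h2 := hC a ⟨le_rfl, hab⟩
  simp only [intervalIntegral.integral_same, sub_zero] at h2
  rw [h2, ← h1]
  abel

/-- Integration by parts against a function vanishing at the endpoints. -/
theorem integral_deriv_smul [CompleteSpace F] (hab : a ≤ b) (h : IsPrimitive a b f g)
    {φ : ℝ → ℝ} (hφ : ContDiff ℝ 1 φ) (ha : φ a = 0) (hb : φ b = 0) :
    ∫ t in a..b, deriv φ t • f t = - ∫ t in a..b, φ t • g t := by
  have hφ' : Continuous (deriv φ) := hφ.continuous_deriv le_rfl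
  have hfc : ContinuousOn f (uIcc a b) := (h.absolutelyContinuous hab).continuousOn
  have i1 : IntervalIntegrable (fun t => deriv φ t • f t) volume a b :=
    (hφ'.continuousOn.smul hfc).intervalIntegrable
  have i2 : IntervalIntegrable (fun t => φ t • g t) volume a b :=
    h.integrable.continuousOn_smul hφ.continuous.continuousOn
  -- The product `φ f` is absolutely continuous, so it is the integral of its a.e. derivative; its
  -- values at both ends vanish.
  have key : IsPrimitive a b (fun t => φ t • f t) (fun t => φ t • g t + deriv φ t • f t) := by
    refine of_ae_hasDerivAt hab ?_ (i2.add i1) ?_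
    · exact (hφ.contDiffOn.absolutelyContinuousOnInterval).fun_smul (h.absolutelyContinuous hab)
    · filter_upwards [h.ae_hasDerivAt hab] with t ht hm
      exact ((hφ.differentiable one_ne_zero) t).hasDerivAt.smul (ht hm)
  have := key.eq_add b ⟨hab, le_rfl⟩
  rw [intervalIntegral.integral_add i2 i1] at this
  simp only [ha, hb, zero_smul, zero_add] at this
  rw [eq_neg_iff_add_eq_zero, add_comm]
  exact this.symm

end IsPrimitive

/-! ### The lemma of du Bois-Reymond -/

theorem contDiff_integral_of_contDiff {ψ : ℝ → ℝ} (hψ : ContDiff ℝ ∞ ψ) (a : ℝ) :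
    ContDiff ℝ ∞ (fun t => ∫ s in a..t, ψ s) := by
  have hd : ∀ t, HasDerivAt (fun t => ∫ s in a..t, ψ s) (ψ t) t := fun t =>
    intervalIntegral.integral_hasDerivAt_right (hψ.continuous.intervalIntegrable _ _)
      hψ.continuous.aestronglyMeasurable.stronglyMeasurableAtFilter hψ.continuous.continuousAt
  rw [contDiff_infty_iff_deriv]
  refine ⟨fun t => (hd t).differentiableAt, ?_⟩
  rwa [show deriv (fun t => ∫ s in a..t, ψ s) = ψ from funext fun t => (hd t).deriv]

theorem deriv_integral_of_contDiff {ψ : ℝ → ℝ} (hψ : ContDiff ℝ ∞ ψ) (a : ℝ) :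
    deriv (fun t => ∫ s in a..t, ψ s) = ψ :=
  funext fun _ => (intervalIntegral.integral_hasDerivAt_right
    (hψ.continuous.intervalIntegrable _ _)
    hψ.continuous.aestronglyMeasurable.stronglyMeasurableAtFilter hψ.continuous.continuousAt).deriv

/-- A compact subset of `(a, b)` is contained in some `[c, d] ⊆ (a, b)`. -/
theorem exists_Icc_superset {K : Set ℝ} (hK : IsCompact K) {a b : ℝ} (hab : a < b)
    (h : K ⊆ Ioo a b) : ∃ c d, a < c ∧ c ≤ d ∧ d < b ∧ K ⊆ Icc c d := by
  rcases K.eq_empty_or_nonempty with rfl | hne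
  · exact ⟨(a + b) / 2, (a + b) / 2, by linarith, le_rfl, by linarith, empty_subset _⟩
  · have h1 := h (hK.sInf_mem hne)
    have h2 := h (hK.sSup_mem hne)
    refine ⟨sInf K, sSup K, h1.1, ?_, h2.2, fun t ht =>
      ⟨csInf_le hK.bddBelow ht, le_csSup hK.bddAbove ht⟩⟩
    exact csInf_le hK.bddBelow (hK.sSup_mem hne)

theorem exists_bump_integral_eq_one {a b : ℝ} (hab : a < b) :
    ∃ η : ℝ → ℝ, ContDiff ℝ ∞ η ∧ HasCompactSupport η ∧ tsupport η ⊆ Ioo a b ∧ ∫ t, η t = 1 := by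
  let η : ContDiffBump ((a + b) / 2) := ⟨(b - a) / 8, (b - a) / 4, by linarith, by linarith⟩
  refine ⟨η.normed volume, η.contDiff_normed, η.hasCompactSupport_normed, ?_, η.integral_normed⟩
  rw [η.tsupport_normed_eq, Real.closedBall_eq_Icc]
  intro t ht
  simp only [η, mem_Icc] at ht
  constructor <;> linarith [ht.1, ht.2]

/-- Subtracting from a test function `ψ` the multiple `(∫ ψ) η` of a bump of unit mass leaves a
function of mean zero, which is the derivative of a test function. The constant must therefore be `∫
η f`. -/
theorem ae_eq_const_of_integral_deriv_smul_eq_zero [CompleteSpace F] {a b : ℝ} (hab : a < b)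
    {f : ℝ → F} (hf : IntegrableOn f (Ioo a b))
    (h : ∀ φ : ℝ → ℝ, ContDiff ℝ ∞ φ → HasCompactSupport φ → tsupport φ ⊆ Ioo a b →
      ∫ t in Ioo a b, deriv φ t • f t = 0) :
    ∃ c : F, ∀ᵐ t, t ∈ Ioo a b → f t = c := by
  obtain ⟨η, hη, hηc, hηs, hη1⟩ := exists_bump_integral_eq_one hab
  have hsm : ∀ ψ : ℝ → ℝ, ContDiff ℝ ∞ ψ → HasCompactSupport ψ →
      IntegrableOn (fun t => ψ t • f t) (Ioo a b) := fun ψ hψ hψc => by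
    obtain ⟨M, hM⟩ := hψc.exists_bound_of_continuous hψ.continuous
    exact hf.bdd_smul M hψ.continuous.aestronglyMeasurable (Filter.Eventually.of_forall hM)
  refine ⟨∫ t in Ioo a b, η t • f t, ?_⟩
  set c := ∫ t in Ioo a b, η t • f t with hc
  have key := isOpen_Ioo.ae_eq_zero_of_integral_contDiff_smul_eq_zero
    (f := fun t => f t - c) (U := Ioo a b) (μ := volume)
    ((hf.sub (by simp)).locallyIntegrableOn) ?_
  · filter_upwards [key] with t ht hm
    exact sub_eq_zero.1 (ht hm)
  intro ψ hψ hψc hψs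
  obtain ⟨c₀, d₀, hac, hcd, hdb, hK⟩ := exists_Icc_superset (hψc.union hηc) hab
    (union_subset hψs hηs)
  have hψ0 : ∀ t, t ∉ Icc c₀ d₀ → ψ t = 0 := fun t ht =>
    image_eq_zero_of_notMem_tsupport fun hh => ht (hK (Or.inl hh))
  have hη0 : ∀ t, t ∉ Icc c₀ d₀ → η t = 0 := fun t ht =>
    image_eq_zero_of_notMem_tsupport fun hh => ht (hK (Or.inr hh))
  set I := ∫ t, ψ t with hI
  let ζ : ℝ → ℝ := fun t => ψ t - I * η t
  have hζ : ContDiff ℝ ∞ ζ := hψ.sub (contDiff_const.mul hη)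
  have hζ0 : ∀ t, t ∉ Icc c₀ d₀ → ζ t = 0 := fun t ht => by simp [ζ, hψ0 t ht, hη0 t ht]
  have hζi : Integrable ζ := (hψ.continuous.integrable_of_hasCompactSupport hψc).sub
    ((hη.continuous.integrable_of_hasCompactSupport hηc).const_mul I)
  have hζI : ∫ t, ζ t = 0 := by
    simp only [ζ]
    rw [integral_sub (hψ.continuous.integrable_of_hasCompactSupport hψc)
      ((hη.continuous.integrable_of_hasCompactSupport hηc).const_mul I), integral_const_mul, hη1]
    simp [hI]
  -- To the right of the supports `Φ` equals the total integral of `ζ`, which is zero; this makes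
  -- `Φ` an admissible test function.
  let Φ : ℝ → ℝ := fun t => ∫ s in a..t, ζ s
  have hΦ0 : ∀ t, t ∉ Icc c₀ d₀ → Φ t = 0 := by
    intro t ht
    rw [mem_Icc, not_and_or, not_le, not_le] at ht
    rcases ht with ht | ht
    · refine intervalIntegral.integral_zero_ae (Filter.Eventually.of_forall fun s hs => hζ0 s ?_)
      intro hs'
      rcases le_max_iff.1 hs.2 with h | h <;> linarith [hs'.1]
    · have : Φ t = ∫ s in Ioc a t, ζ s := intervalIntegral.integral_of_le (by linarith)
      rw [this, setIntegral_eq_integral_of_forall_compl_eq_zero, hζI]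
      intro s hs
      refine hζ0 s fun hs' => hs ⟨by linarith [hs'.1], by linarith [hs'.2]⟩
  have hΦs : tsupport Φ ⊆ Icc c₀ d₀ := closure_minimal (fun t ht => by
    by_contra hh
    exact ht (hΦ0 t hh)) isClosed_Icc
  have hz := h Φ (contDiff_integral_of_contDiff hζ a)
    (isCompact_Icc.of_isClosed_subset (isClosed_tsupport _) hΦs)
    (hΦs.trans (Icc_subset_Ioo hac hdb))
  rw [deriv_integral_of_contDiff hζ a] at hz
  have e1 : ∫ t, ψ t • (f t - c) = ∫ t in Ioo a b, ψ t • (f t - c) := by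
    refine (setIntegral_eq_integral_of_forall_compl_eq_zero fun t ht => ?_).symm
    rw [hψ0 t fun hh => ht (Icc_subset_Ioo hac hdb hh), zero_smul]
  have e2 : ∫ t in Ioo a b, ψ t = I := by
    refine (setIntegral_eq_integral_of_forall_compl_eq_zero fun t ht => ?_)
    rw [hψ0 t fun hh => ht (Icc_subset_Ioo hac hdb hh)]
  rw [e1]
  have i3 : Integrable ψ (volume.restrict (Ioo a b)) :=
    (hψ.continuous.integrable_of_hasCompactSupport hψc).integrableOn
  simp only [smul_sub]
  rw [integral_sub (hsm ψ hψ hψc) (i3.smul_const c), integral_smul_const, e2, hc,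
    ← integral_smul, ← integral_sub (hsm ψ hψ hψc)
      (show Integrable (fun t => I • η t • f t) _ from (hsm η hη hηc).smul I), ← hz]
  refine integral_congr_ae (Filter.Eventually.of_forall fun t => ?_)
  simp [ζ, sub_smul, mul_smul]

/-- A function with integrable distributional derivative is almost everywhere equal to a
primitive of that derivative. -/
theorem exists_ae_eq_add_integral [CompleteSpace F] {a b : ℝ} (hab : a < b) {f g : ℝ → F}
    (hf : IntegrableOn f (Ioo a b)) (hg : IntegrableOn g (Ioo a b))
    (h : ∀ φ : ℝ → ℝ, ContDiff ℝ ∞ φ → HasCompactSupport φ → tsupport φ ⊆ Ioo a b →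
      ∫ t in Ioo a b, deriv φ t • f t = - ∫ t in Ioo a b, φ t • g t) :
    ∃ c : F, ∀ᵐ t, t ∈ Ioo a b → f t = c + ∫ s in a..t, g s := by
  have hgi : IntervalIntegrable g volume a b :=
    (intervalIntegrable_iff_integrableOn_Ioo_of_le hab.le).2 hg
  have hG : IsPrimitive a b (fun t => ∫ s in a..t, g s) g := ⟨hgi, by simp⟩
  have hGc := hG.continuousOn hab.le
  have hGi : IntegrableOn (fun t => ∫ s in a..t, g s) (Ioo a b) :=
    (hGc.integrableOn_compact isCompact_Icc).mono_set Ioo_subset_Icc_self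
  have hsm : ∀ ψ : ℝ → ℝ, Continuous ψ → HasCompactSupport ψ → ∀ u : ℝ → F,
      IntegrableOn u (Ioo a b) → IntegrableOn (fun t => ψ t • u t) (Ioo a b) :=
    fun ψ hψ hψc u hu => by
    obtain ⟨M, hM⟩ := hψc.exists_bound_of_continuous hψ
    exact hu.bdd_smul M hψ.aestronglyMeasurable (Filter.Eventually.of_forall hM)
  -- The difference of `f` and the primitive of `g` has zero distributional derivative.
  obtain ⟨c, hc⟩ := ae_eq_const_of_integral_deriv_smul_eq_zero hab (hf.sub hGi) (by
    intro φ hφ hφc hφs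
    have hφ' : Continuous (deriv φ) := hφ.continuous_deriv (by simp)
    have e := hG.integral_deriv_smul hab.le (hφ.of_le (by simp))
      (image_eq_zero_of_notMem_tsupport fun hh => by simpa using hφs hh)
      (image_eq_zero_of_notMem_tsupport fun hh => by simpa using hφs hh)
    rw [intervalIntegral.integral_of_le hab.le, intervalIntegral.integral_of_le hab.le,
      integral_Ioc_eq_integral_Ioo, integral_Ioc_eq_integral_Ioo] at e
    simp only [Pi.sub_apply, smul_sub]
    rw [integral_sub (hsm _ hφ' hφc.deriv f hf) (hsm _ hφ' hφc.deriv _ hGi), e, h φ hφ hφc hφs,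
      sub_self])
  refine ⟨c, ?_⟩
  filter_upwards [hc] with t ht hm
  rw [← ht hm]
  simp

/-! ### Loops of class `H¹` -/

theorem velocity_ae_eq {T : ℝ} (hT : 0 < T) {x g : ℝ → Plane} (h : IsPrimitive 0 T x g) :
    ∀ᵐ t, t ∈ Icc 0 T → velocity T x t = g t := by
  filter_upwards [h.ae_hasDerivAt hT.le] with t ht hm
  exact (ht hm).hasDerivWithinAt.derivWithin (uniqueDiffOn_Icc hT t hm)

theorem mem_HOneLoops_of_isPrimitive {T : ℝ} (hT : 0 < T) {x g : ℝ → Plane}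
    (h : IsPrimitive 0 T x g) (hg : MemLp g 2 (volume.restrict (Icc 0 T))) (h0 : x 0 = x T) :
    x ∈ HOneLoops T := by
  have hxc := h.continuousOn hT.le
  have hr : volume.restrict (Ioo 0 T) = volume.restrict (Icc 0 T) :=
    Measure.restrict_congr_set Ioo_ae_eq_Icc
  have hxi : IntegrableOn x (Icc 0 T) := hxc.integrableOn_compact isCompact_Icc
  obtain ⟨M, hM⟩ := isCompact_Icc.exists_bound_of_continuousOn hxc
  refine ⟨hxc, ⟨?_, g, by rwa [hr], ?_, ?_, ?_⟩, h0⟩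
  · rw [hr]
    exact MemLp.of_bound hxi.aestronglyMeasurable M
      ((ae_restrict_iff' measurableSet_Icc).2 (Filter.Eventually.of_forall hM))
  · exact (hxi.mono_set Ioo_subset_Icc_self).locallyIntegrableOn
  · exact ((intervalIntegrable_iff_integrableOn_Ioo_of_le hT.le).1 h.integrable).locallyIntegrableOn
  · rintro φ ⟨hφ, -, hφs⟩
    have e := h.integral_deriv_smul hT.le (hφ.of_le (by simp))
      (image_eq_zero_of_notMem_tsupport fun hh => by simpa using hφs hh)
      (image_eq_zero_of_notMem_tsupport fun hh => by simpa using hφs hh)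
    rwa [intervalIntegral.integral_of_le hT.le, intervalIntegral.integral_of_le hT.le,
      integral_Ioc_eq_integral_Ioo, integral_Ioc_eq_integral_Ioo] at e

theorem exists_isPrimitive_of_mem_HOneLoops {T : ℝ} (hT : 0 < T) {x : ℝ → Plane}
    (hx : x ∈ HOneLoops T) :
    ∃ g, MemLp g 2 (volume.restrict (Icc 0 T)) ∧ IsPrimitive 0 T x g := by
  obtain ⟨hxc, ⟨-, g, hg, -, -, hw⟩, -⟩ := hx
  have hr : volume.restrict (Ioo 0 T) = volume.restrict (Icc 0 T) :=
    Measure.restrict_congr_set Ioo_ae_eq_Icc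
  have hgi : IntegrableOn g (Ioo 0 T) := hg.integrable (by norm_num)
  rw [hr] at hg
  refine ⟨g, hg, (intervalIntegrable_iff_integrableOn_Ioo_of_le hT.le).2 hgi, ?_⟩
  have hxi : IntegrableOn x (Icc 0 T) := hxc.integrableOn_compact isCompact_Icc
  obtain ⟨c, hc⟩ := exists_ae_eq_add_integral hT (hxi.mono_set Ioo_subset_Icc_self) hgi
    (fun φ h1 h2 h3 => hw φ ⟨h1, h2, h3⟩)
  have hG : IsPrimitive 0 T (fun t => c + ∫ s in 0..t, g s) g :=
    ⟨(intervalIntegrable_iff_integrableOn_Ioo_of_le hT.le).2 hgi, by simp⟩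
  -- Both sides are continuous, so equality a.e. becomes equality on all of `[0, T]`.
  have heq : EqOn x (fun t => c + ∫ s in 0..t, g s) (Icc 0 T) := by
    refine Measure.eqOn_Icc_of_ae_eq volume hT.ne ?_ hxc (hG.continuousOn hT.le)
    rw [← hr]
    exact (ae_restrict_iff' measurableSet_Ioo).2 hc
  intro t ht
  rw [heq ht, heq ⟨le_rfl, hT.le⟩]
  simp

/-- Replaces the unspecified weak derivative by the pointwise one used in the action; the two agree
a.e. by Lebesgue differentiation. -/
theorem isPrimitive_velocity {T : ℝ} (hT : 0 < T) {x : ℝ → Plane} (hx : x ∈ HOneLoops T) :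
    IsPrimitive 0 T x (velocity T x) := by
  obtain ⟨g, -, h⟩ := exists_isPrimitive_of_mem_HOneLoops hT hx
  have hae := velocity_ae_eq hT h
  refine IsPrimitive.of_ae_hasDerivAt hT.le (h.absolutelyContinuous hT.le) ?_ ?_
  · refine h.integrable.congr_ae ?_
    rw [uIoc_of_le hT.le]
    refine (ae_restrict_iff' measurableSet_Ioc).2 ?_
    filter_upwards [hae] with t ht hm
    exact (ht (Ioc_subset_Icc_self hm)).symm
  · filter_upwards [hae, h.ae_hasDerivAt hT.le] with t h1 h2 hm
    rw [h1 hm]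
    exact h2 hm

theorem memLp_velocity {T : ℝ} (hT : 0 < T) {x : ℝ → Plane} (hx : x ∈ HOneLoops T) :
    MemLp (velocity T x) 2 (volume.restrict (Icc 0 T)) := by
  obtain ⟨g, hg, h⟩ := exists_isPrimitive_of_mem_HOneLoops hT hx
  refine hg.ae_eq ((ae_restrict_iff' measurableSet_Icc).2 ?_)
  filter_upwards [velocity_ae_eq hT h] with t ht hm
  exact (ht hm).symm

/-! ### The action as a real number -/

/-- The hypothesis `z ≠ 0` is essential: at a collision the left side is `∞`, while the real number
`1 / 0` is `0`. -/
theorem enorm_lagrangian_eq {v z : Plane} (hz : z ≠ 0) :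
    ‖v‖ₑ ^ 2 / 2 + ‖z‖ₑ⁻¹ = ENNReal.ofReal (‖v‖ ^ 2 / 2 + 1 / ‖z‖) := by
  have hz' : 0 < ‖z‖ := norm_pos_iff.2 hz
  rw [ENNReal.ofReal_add (by positivity) (by positivity), ENNReal.ofReal_div_of_pos two_pos,
    ENNReal.ofReal_pow (norm_nonneg _), ofReal_norm, one_div, ENNReal.ofReal_inv_of_pos hz',
    ofReal_norm]
  simp

theorem action_eq_coe {T : ℝ} {U : ℝ → Plane → ℝ} {x : ℝ → Plane} {k : ℝ → ℝ}
    (hk : IntegrableOn k (Icc 0 T)) (hk0 : ∀ᵐ t ∂volume.restrict (Icc 0 T), 0 ≤ k t)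
    (h : ∀ᵐ t ∂volume.restrict (Icc 0 T),
      ‖velocity T x t‖ₑ ^ 2 / 2 + ‖x t‖ₑ⁻¹ = ENNReal.ofReal (k t)) :
    action T U x = (((∫ t in Icc 0 T, k t) + ∫ t in Icc 0 T, U t (x t) : ℝ) : EReal) := by
  rw [action, lintegral_congr_ae h, ← ofReal_integral_eq_lintegral_ofReal hk hk0,
    EReal.coe_ennreal_ofReal, max_eq_left (integral_nonneg_of_ae hk0), EReal.coe_add]

/-- Finite action bounds `∫ 1/|x|` computed in `[0,∞]`, and an integrand with finite integral is
infinite only on a null set. -/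
theorem ae_ne_zero_of_action_lt_top {T : ℝ} {U : ℝ → Plane → ℝ} {x : ℝ → Plane}
    (hx : ContinuousOn x (Icc 0 T)) (h : action T U x < ⊤) :
    (∀ᵐ t, t ∈ Icc 0 T → x t ≠ 0) ∧ IntegrableOn (fun t => 1 / ‖x t‖) (Icc 0 T) := by
  have hxm : AEMeasurable x (volume.restrict (Icc 0 T)) := hx.aemeasurable measurableSet_Icc
  have hfin : ∫⁻ t in Icc 0 T, ‖x t‖ₑ⁻¹ < ⊤ := by
    refine lt_of_le_of_lt (lintegral_mono fun t => ?_) (?_ : ∫⁻ t in Icc 0 T,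
      (‖velocity T x t‖ₑ ^ 2 / 2 + ‖x t‖ₑ⁻¹) < ⊤)
    · exact le_add_self
    · rw [lt_top_iff_ne_top]
      intro hh
      rw [action, hh] at h
      simp at h
  have hne := ae_lt_top' hxm.enorm.inv hfin.ne
  rw [ae_restrict_iff' measurableSet_Icc] at hne
  have hne' : ∀ᵐ t, t ∈ Icc 0 T → x t ≠ 0 := by
    filter_upwards [hne] with t ht hm h0
    simpa [h0] using ht hm
  refine ⟨hne', ?_, ?_⟩
  · simp only [one_div]
    exact hxm.norm.inv.aestronglyMeasurable
  · rw [hasFiniteIntegral_iff_enorm]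
    refine lt_of_le_of_lt (lintegral_mono_ae ?_) hfin
    rw [ae_restrict_iff' measurableSet_Icc]
    filter_upwards [hne'] with t ht hm
    rw [one_div, enorm_inv (norm_ne_zero_iff.2 (ht hm)), enorm_norm]

/-! ### The action takes a finite value -/

/-- The unit circle traversed once has winding number one and bounded integrand; it serves only to
make the minimum finite. -/
theorem exists_admissible_action_lt_top {T : ℝ} (hT : 0 < T) (U : ℝ → Plane → ℝ) :
    ∃ y ∈ admissibleLoops T, action T U y < ⊤ := by
  set w : ℝ := 2 * Real.pi / T with hw
  have hwT : w * T = 2 * Real.pi := by rw [hw]; field_simp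
  let y : ℝ → Plane := fun t => !₂[Real.cos (w * t), Real.sin (w * t)]
  let g : ℝ → Plane := fun t => !₂[-(w * Real.sin (w * t)), w * Real.cos (w * t)]
  have hgc : Continuous g := by
    refine (PiLp.continuous_toLp 2 _).comp (continuous_pi fun i => ?_)
    fin_cases i <;> simp <;> fun_prop
  have hd : ∀ t, HasDerivAt y (g t) t := by
    intro t
    have hl : HasDerivAt (fun t : ℝ => w * t) w t := by
      simpa using (hasDerivAt_id t).const_mul w
    have hpi : HasDerivAt (fun t => ![Real.cos (w * t), Real.sin (w * t)])
        ![-(w * Real.sin (w * t)), w * Real.cos (w * t)] t := by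
      rw [hasDerivAt_pi]
      intro i
      fin_cases i
      · simpa [mul_comm] using hl.cos
      · simpa [mul_comm] using hl.sin
    exact ((PiLp.continuousLinearEquiv 2 ℝ (fun _ : Fin 2 => ℝ)).symm.toContinuousLinearMap
      |>.hasFDerivAt.comp_hasDerivAt t hpi)
  have hyc : Continuous y := continuous_iff_continuousAt.2 fun t => (hd t).continuousAt
  have hne : ∀ t, y t ≠ 0 := by
    intro t h0
    have h1 : Real.cos (w * t) = 0 := congrArg (fun z : Plane => z 0) h0
    have h2 : Real.sin (w * t) = 0 := congrArg (fun z : Plane => z 1) h0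
    simpa [h1, h2] using Real.sin_sq_add_cos_sq (w * t)
  have hp : IsPrimitive 0 T y g := by
    refine ⟨hgc.intervalIntegrable _ _, fun t _ => ?_⟩
    rw [intervalIntegral.integral_eq_sub_of_hasDerivAt (fun s _ => hd s)
      (hgc.intervalIntegrable _ _)]
    abel
  have hH : y ∈ HOneLoops T := by
    refine mem_HOneLoops_of_isPrimitive hT hp ?_ ?_
    · obtain ⟨M, hM⟩ := isCompact_Icc.exists_bound_of_continuousOn (s := Icc 0 T) hgc.continuousOn
      exact MemLp.of_bound hgc.aestronglyMeasurable M
        ((ae_restrict_iff' measurableSet_Icc).2 (Filter.Eventually.of_forall hM))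
    · simp [y, hwT]
  refine ⟨y, Or.inr ⟨hH, fun t _ => hne t, 1, ⟨fun _ => 1, fun t => w * t, continuousOn_const,
    by fun_prop, fun t _ => ⟨one_pos, by simp [y]⟩, ?_⟩, one_ne_zero⟩, ?_⟩
  · have := Real.pi_pos
    simp only [hwT, mul_zero, sub_zero]
    field_simp
  · rw [action_eq_coe (k := fun t => ‖g t‖ ^ 2 / 2 + 1 / ‖y t‖)]
    · exact EReal.coe_lt_top _
    · refine ContinuousOn.integrableOn_compact isCompact_Icc (Continuous.continuousOn ?_)
      exact ((hgc.norm.pow 2).div_const 2).add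
        (continuous_const.div hyc.norm fun t => norm_ne_zero_iff.2 (hne t))
    · exact Filter.Eventually.of_forall fun t => by positivity
    · rw [ae_restrict_iff' measurableSet_Icc]
      filter_upwards [velocity_ae_eq hT hp] with t ht hm
      rw [ht hm, enorm_lagrangian_eq (hne t)]

/-! ### The potential along a loop -/

theorem integrableOn_clm_apply {E G : Type*} [NormedAddCommGroup E] [NormedSpace ℝ E]
    [NormedAddCommGroup G] [NormedSpace ℝ G] {a b : ℝ} {L : ℝ → E →L[ℝ] G} {w : ℝ → E}
    (hL : ContinuousOn L (Icc a b)) (hw : IntegrableOn w (Icc a b)) :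
    IntegrableOn (fun t => L t (w t)) (Icc a b) := by
  obtain ⟨M, hM⟩ := isCompact_Icc.exists_bound_of_continuousOn hL
  refine Integrable.mono' (hw.norm.const_mul M)
    ((ContinuousLinearMap.id ℝ (E →L[ℝ] G)).aestronglyMeasurable_comp₂
      (hL.aestronglyMeasurable_of_isCompact isCompact_Icc measurableSet_Icc)
      hw.aestronglyMeasurable) ?_
  rw [ae_restrict_iff' measurableSet_Icc]
  refine Filter.Eventually.of_forall fun t ht => ?_
  exact (L t).le_of_opNorm_le (hM t ht) _

theorem inner_gradient_eq {U : ℝ → Plane → ℝ}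
    (hU : ContDiff ℝ 1 (fun p : ℝ × Plane => U p.1 p.2)) (t : ℝ) (z v : Plane) :
    inner ℝ (gradient (U t) z) v = fderiv ℝ (fun p : ℝ × Plane => U p.1 p.2) (t, z) (0, v) := by
  have h : HasFDerivAt (U t) ((fderiv ℝ (fun p : ℝ × Plane => U p.1 p.2) (t, z)).comp
      (ContinuousLinearMap.inr ℝ ℝ Plane)) z :=
    ((hU.differentiable one_ne_zero) (t, z)).hasFDerivAt.comp z (hasFDerivAt_prodMk_right t z)
  rw [gradient, h.fderiv, InnerProductSpace.toDual_symm_apply]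
  simp

theorem isPrimitive_prodMk {T : ℝ} {x g : ℝ → Plane} (h : IsPrimitive 0 T x g) (hT : 0 ≤ T) :
    IsPrimitive 0 T (fun t => (t, x t)) (fun t => ((1 : ℝ), g t)) := by
  have hi : IntervalIntegrable (fun t => ((1 : ℝ), g t)) volume 0 T := by
    have h1 := h.integrable
    have h0 : IntervalIntegrable (fun _ : ℝ => (1 : ℝ)) volume 0 T := intervalIntegrable_const
    rw [intervalIntegrable_iff] at h0 h1 ⊢
    exact Integrable.prodMk h0 h1
  refine ⟨hi, fun t ht => ?_⟩
  have hit : IntervalIntegrable (fun t => ((1 : ℝ), g t)) volume 0 t :=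
    hi.mono_set (by rw [uIcc_of_le hT, uIcc_of_le ht.1]; exact Icc_subset_Icc_right ht.2)
  have e1 := (ContinuousLinearMap.fst ℝ ℝ Plane).intervalIntegral_comp_comm hit
  have e2 := (ContinuousLinearMap.snd ℝ ℝ Plane).intervalIntegral_comp_comm hit
  simp only [ContinuousLinearMap.coe_fst', ContinuousLinearMap.coe_snd'] at e1 e2
  refine Prod.ext ?_ ?_
  · rw [Prod.fst_add, ← e1]
    simp
  · rw [Prod.snd_add, ← e2]
    exact h.eq_add t ht

/-- The chain rule for `t ↦ U(t, x(t))`. -/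
theorem isPrimitive_potential {U : ℝ → Plane → ℝ}
    (hU : ContDiff ℝ 1 (fun p : ℝ × Plane => U p.1 p.2)) {T : ℝ} (hT : 0 ≤ T) {x g : ℝ → Plane}
    (h : IsPrimitive 0 T x g) :
    IsPrimitive 0 T (fun t => U t (x t))
      (fun t => fderiv ℝ (fun p : ℝ × Plane => U p.1 p.2) (t, x t) (1, g t)) := by
  set W : ℝ × Plane → ℝ := fun p => U p.1 p.2 with hW
  have hp := isPrimitive_prodMk h hT
  have hpc := hp.continuousOn hT
  have hxc := h.continuousOn hT
  have hDc : Continuous (fderiv ℝ W) := hU.continuous_fderiv one_ne_zero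
  -- On the compact convex set `[0,T] × closedBall 0 R`, which contains the graph of `x`, the `C¹`
  -- potential is Lipschitz. Its composition with the absolutely continuous curve `(t, x(t))` is
  -- thus absolutely continuous.
  obtain ⟨R, hR⟩ := isCompact_Icc.exists_bound_of_continuousOn hxc
  have hK : IsCompact (Icc 0 T ×ˢ Metric.closedBall (0 : Plane) R) :=
    isCompact_Icc.prod (isCompact_closedBall _ _)
  obtain ⟨L, hL⟩ := hK.exists_bound_of_continuousOn hDc.continuousOn
  have hmem : ∀ t ∈ Icc 0 T, (t, x t) ∈ Icc 0 T ×ˢ Metric.closedBall (0 : Plane) R := fun t ht =>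
    ⟨ht, by simpa using hR t ht⟩
  have hconv : Convex ℝ (Icc 0 T ×ˢ Metric.closedBall (0 : Plane) R) :=
    (convex_Icc _ _).prod (convex_closedBall _ _)
  refine IsPrimitive.of_ae_hasDerivAt hT ?_ ?_ ?_
  · refine absolutelyContinuousOnInterval_of_dist_le
      (m := fun t => |L| • (t, x t)) ?_ ?_
    · exact (hp.absolutelyContinuous hT).const_smul |L|
    · rw [uIcc_of_le hT]
      intro s hs t ht
      rw [dist_smul₀, Real.norm_eq_abs, abs_abs, dist_eq_norm, dist_eq_norm]
      refine (hconv.norm_image_sub_le_of_norm_fderiv_le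
        (fun p _ => (hU.differentiable one_ne_zero) p) hL (hmem t ht) (hmem s hs)).trans ?_
      exact mul_le_mul_of_nonneg_right (le_abs_self L) (norm_nonneg _)
  · have hi := (intervalIntegrable_iff_integrableOn_Icc_of_le hT).1 hp.integrable
    exact (intervalIntegrable_iff_integrableOn_Icc_of_le hT).2
      (integrableOn_clm_apply (hDc.comp_continuousOn hpc) hi)
  · filter_upwards [hp.ae_hasDerivAt hT] with t ht hm
    exact ((hU.differentiable one_ne_zero) (t, x t)).hasFDerivAt.comp_hasDerivAt t (ht hm)

/-! ### Reparametrized loops -/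

/-- Take `y = x ∘ σ⁻¹` and change variables by `t = σ(s)`. Since `ẏ(σ(s)) = ẋ(s) / σ'(s)`, the
kinetic term picks up `1/σ'` and the others pick up `σ'`. The bounds on `σ'` keep `ẏ` in `L²` and
the new integrand integrable. -/
theorem exists_reparametrized_loop {T : ℝ} (hT : 0 < T) {U : ℝ → Plane → ℝ} {x : ℝ → Plane}
    (hx : x ∈ HOneLoops T) (hne : ∀ᵐ t, t ∈ Icc 0 T → x t ≠ 0)
    (hP : IntegrableOn (fun t => 1 / ‖x t‖) (Icc 0 T)) {σ σ' : ℝ → ℝ}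
    (hσ : ∀ s, HasDerivAt σ (σ' s) s) (hσc : Continuous σ') (hlow : ∀ s, 1 / 2 ≤ σ' s)
    (hup : ∀ s, σ' s ≤ 2)
    (hsurj : Function.Surjective σ) (h0 : σ 0 = 0) (h1 : σ T = T) :
    ∃ y ∈ HOneLoops T, (∀ s, y (σ s) = x s) ∧
      action T U y = (((∫ s in Icc 0 T, (‖velocity T x s‖ ^ 2 / 2 / σ' s + σ' s * (1 / ‖x s‖))) +
        ∫ s in Icc 0 T, σ' s * U (σ s) (x s) : ℝ) : EReal) := by
  have hpos : ∀ s, 0 < σ' s := fun s => by linarith [hlow s]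
  have hmono : StrictMono σ := strictMono_of_deriv_pos fun s => by rw [(hσ s).deriv]; exact hpos s
  let e : ℝ ≃o ℝ := hmono.orderIsoOfSurjective σ hsurj
  have heσ : ∀ s, e s = σ s := fun s => rfl
  have hes : ∀ t, σ (e.symm t) = t := fun t => e.apply_symm_apply t
  have hse : ∀ s, e.symm (σ s) = s := fun s => e.symm_apply_apply s
  have himg : ∀ s, σ '' Icc 0 s = Icc 0 (σ s) := fun s => by
    have := e.image_Icc 0 s
    rw [heσ, heσ, h0] at this
    exact this
  have himgT : σ '' Icc 0 T = Icc 0 T := by rw [himg, h1]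
  have hW : ∀ r : Set ℝ, ∀ s ∈ r, HasDerivWithinAt σ (σ' s) r s := fun r s _ =>
    (hσ s).hasDerivWithinAt
  have habs : ∀ s, |σ' s| = σ' s := fun s => abs_of_pos (hpos s)
  have hprim := isPrimitive_velocity hT hx
  have hLp := memLp_velocity hT hx
  have hvi : IntegrableOn (velocity T x) (Icc 0 T) := hLp.integrable (by norm_num)
  have hv2 : IntegrableOn (fun s => ‖velocity T x s‖ ^ 2) (Icc 0 T) :=
    (memLp_two_iff_integrable_sq_norm hLp.aestronglyMeasurable).1 hLp
  let y : ℝ → Plane := fun t => x (e.symm t)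
  let g : ℝ → Plane := fun t => (σ' (e.symm t))⁻¹ • velocity T x (e.symm t)
  have hyσ : ∀ s, y (σ s) = x s := fun s => by simp only [y, hse]
  have hgσ : ∀ s, g (σ s) = (σ' s)⁻¹ • velocity T x s := fun s => by simp only [g, hse]
  have hgσ' : ∀ s, |σ' s| • g (σ s) = velocity T x s := fun s => by
    rw [hgσ, habs, smul_inv_smul₀ (hpos s).ne']
  have hgi : IntegrableOn g (Icc 0 T) := by
    rw [← himgT, integrableOn_image_iff_integrableOn_abs_deriv_smul measurableSet_Icc
      (hW _) hmono.injective.injOn]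
    simpa only [hgσ'] using hvi
  have hprimy : IsPrimitive 0 T y g := by
    refine ⟨(intervalIntegrable_iff_integrableOn_Icc_of_le hT.le).2 hgi, fun t ht => ?_⟩
    obtain ⟨s, hs, rfl⟩ : t ∈ σ '' Icc 0 T := by rwa [himgT]
    rw [intervalIntegral.integral_of_le ht.1, ← integral_Icc_eq_integral_Ioc, ← himg,
      integral_image_eq_integral_abs_deriv_smul measurableSet_Icc (hW _) hmono.injective.injOn]
    simp only [hgσ']
    have h00 : y 0 = x 0 := by rw [← hyσ 0, h0]
    rw [hyσ, h00, integral_Icc_eq_integral_Ioc, ← intervalIntegral.integral_of_le hs.1]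
    exact hprim.eq_add s hs
  have hinvb : ∀ s, (σ' s)⁻¹ ≤ 2 := fun s => by
    rw [inv_le_comm₀ (hpos s) two_pos]
    linarith [hlow s]
  have hinvc : Continuous fun s => (σ' s)⁻¹ := hσc.inv₀ fun s => (hpos s).ne'
  have hgLp : MemLp g 2 (volume.restrict (Icc 0 T)) := by
    rw [memLp_two_iff_integrable_sq_norm hgi.aestronglyMeasurable]
    have : IntegrableOn (fun t => ‖g t‖ ^ 2) (Icc 0 T) := by
      rw [← himgT, integrableOn_image_iff_integrableOn_abs_deriv_smul measurableSet_Icc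
        (hW _) hmono.injective.injOn]
      have : IntegrableOn (fun s => (σ' s)⁻¹ * ‖velocity T x s‖ ^ 2) (Icc 0 T) := by
        refine Integrable.bdd_mul (c := 2) hv2 hinvc.aestronglyMeasurable
          (Filter.Eventually.of_forall fun s => ?_)
        rw [Real.norm_eq_abs, abs_of_pos (inv_pos.2 (hpos s))]
        exact hinvb s
      refine this.congr_fun (fun s _ => ?_) measurableSet_Icc
      have := (hpos s).ne'
      simp only [hgσ, habs, norm_smul, norm_inv, Real.norm_eq_abs, smul_eq_mul]
      field_simp
    exact this
  have hyH : y ∈ HOneLoops T := by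
    refine mem_HOneLoops_of_isPrimitive hT hprimy hgLp ?_
    have h00 : y 0 = x 0 := by rw [← hyσ 0, h0]
    have hTT : y T = x T := by rw [← hyσ T, h1]
    rw [h00, hTT]
    exact hx.2.2
  refine ⟨y, hyH, hyσ, ?_⟩
  have hki : IntegrableOn
      (fun s => ‖velocity T x s‖ ^ 2 / 2 / σ' s + σ' s * (1 / ‖x s‖)) (Icc 0 T) := by
    refine Integrable.add ?_ ?_
    · have : IntegrableOn (fun s => (σ' s)⁻¹ * (‖velocity T x s‖ ^ 2 / 2)) (Icc 0 T) := by
        refine Integrable.bdd_mul (c := 2) (hv2.div_const 2) hinvc.aestronglyMeasurable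
          (Filter.Eventually.of_forall fun s => ?_)
        rw [Real.norm_eq_abs, abs_of_pos (inv_pos.2 (hpos s))]
        exact hinvb s
      refine this.congr_fun (fun s _ => ?_) measurableSet_Icc
      simp only []
      ring
    · refine Integrable.bdd_mul (c := 2) hP hσc.aestronglyMeasurable
        (Filter.Eventually.of_forall fun s => ?_)
      rw [Real.norm_eq_abs, habs]
      exact hup s
  have e1 : ∫⁻ t in Icc 0 T, (‖velocity T y t‖ₑ ^ 2 / 2 + ‖y t‖ₑ⁻¹) =
      ∫⁻ s in Icc 0 T,
        ENNReal.ofReal (‖velocity T x s‖ ^ 2 / 2 / σ' s + σ' s * (1 / ‖x s‖)) := by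
    have : ∫⁻ t in Icc 0 T, (‖velocity T y t‖ₑ ^ 2 / 2 + ‖y t‖ₑ⁻¹) =
        ∫⁻ t in Icc 0 T, (‖g t‖ₑ ^ 2 / 2 + ‖y t‖ₑ⁻¹) := by
      refine lintegral_congr_ae ((ae_restrict_iff' measurableSet_Icc).2 ?_)
      filter_upwards [velocity_ae_eq hT hprimy] with t ht hm
      simp only [ht hm]
    rw [this]
    conv_lhs => rw [← himgT]
    rw [lintegral_image_eq_lintegral_abs_deriv_mul measurableSet_Icc (hW _)
      hmono.injective.injOn]
    refine lintegral_congr_ae ((ae_restrict_iff' measurableSet_Icc).2 ?_)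
    filter_upwards [hne] with s hs hm
    simp only [hgσ, hyσ]
    rw [enorm_lagrangian_eq (hs hm), habs, ← ENNReal.ofReal_mul (hpos s).le]
    congr 1
    rw [norm_smul, norm_inv, Real.norm_eq_abs, habs]
    have := (hpos s).ne'
    field_simp
  have e2 : ∫ t in Icc 0 T, U t (y t) = ∫ s in Icc 0 T, σ' s * U (σ s) (x s) := by
    conv_lhs => rw [← himgT]
    rw [integral_image_eq_integral_abs_deriv_smul measurableSet_Icc (hW _)
      hmono.injective.injOn]
    simp only [hyσ, habs, smul_eq_mul]
  have hk0 : ∀ s, 0 ≤ ‖velocity T x s‖ ^ 2 / 2 / σ' s + σ' s * (1 / ‖x s‖) := fun s => by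
    have := hpos s
    positivity
  rw [action, e1, e2, ← ofReal_integral_eq_lintegral_ofReal hki
    (Filter.Eventually.of_forall hk0), EReal.coe_ennreal_ofReal,
    max_eq_left (integral_nonneg hk0), EReal.coe_add]

/-! ### Variations of the independent variable -/

theorem integrableOn_kinetic {T : ℝ} (hT : 0 < T) {x : ℝ → Plane} (hx : x ∈ HOneLoops T) :
    IntegrableOn (fun t => ‖velocity T x t‖ ^ 2 / 2) (Icc 0 T) :=
  ((memLp_two_iff_integrable_sq_norm (memLp_velocity hT hx).aestronglyMeasurable).1
    (memLp_velocity hT hx)).div_const 2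

theorem action_eq_of_ae_ne_zero {T : ℝ} (hT : 0 < T) {U : ℝ → Plane → ℝ} {x : ℝ → Plane}
    (hx : x ∈ HOneLoops T) (hne : ∀ᵐ t, t ∈ Icc 0 T → x t ≠ 0)
    (hP : IntegrableOn (fun t => 1 / ‖x t‖) (Icc 0 T)) :
    action T U x = (((∫ t in Icc 0 T, (‖velocity T x t‖ ^ 2 / 2 + 1 / ‖x t‖)) +
      ∫ t in Icc 0 T, U t (x t) : ℝ) : EReal) := by
  refine action_eq_coe ((integrableOn_kinetic hT hx).add hP)
    (Filter.Eventually.of_forall fun t => by positivity) ?_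
  rw [ae_restrict_iff' measurableSet_Icc]
  filter_upwards [hne] with t ht hm
  exact enorm_lagrangian_eq (ht hm)

theorem IsTestFunction.eq_zero {T : ℝ} {φ : ℝ → ℝ} (h : IsTestFunction T φ) {t : ℝ}
    (ht : t ∉ Ioo 0 T) : φ t = 0 :=
  image_eq_zero_of_notMem_tsupport fun hh => ht (h.2.2 hh)

theorem IsTestFunction.exists_bound {T : ℝ} {φ : ℝ → ℝ} (h : IsTestFunction T φ) :
    ∃ M, 0 < M ∧ (∀ t, |φ t| ≤ M) ∧ ∀ t, |deriv φ t| ≤ M := by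
  obtain ⟨M, hM⟩ := h.2.1.exists_bound_of_continuous h.1.continuous
  obtain ⟨N, hN⟩ := h.2.1.deriv.exists_bound_of_continuous (h.1.continuous_deriv (by simp))
  refine ⟨|M| + |N| + 1, by positivity, fun t => ?_, fun t => ?_⟩
  · have := hM t
    rw [Real.norm_eq_abs] at this
    linarith [le_abs_self M, abs_nonneg N]
  · have := hN t
    rw [Real.norm_eq_abs] at this
    linarith [le_abs_self N, abs_nonneg M]

/-- A change of time fixing `0` and `T` moves the collision from `t₀` to `t₀ + ε φ(t₀)` but does not
destroy it, so the new loop is a competitor. -/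
theorem action_le_of_reparametrization {T : ℝ} (hT : 0 < T) {U : ℝ → Plane → ℝ}
    {x : ℝ → Plane} (hx : x ∈ collisionLoops T)
    (hmin : IsMinOn (action T U) (admissibleLoops T) x)
    (hne : ∀ᵐ t, t ∈ Icc 0 T → x t ≠ 0)
    (hP : IntegrableOn (fun t => 1 / ‖x t‖) (Icc 0 T)) {φ : ℝ → ℝ} (hφ : IsTestFunction T φ)
    {ε : ℝ} (hε : ∀ t, |ε * deriv φ t| ≤ 1 / 2) :
    (∫ t in Icc 0 T, (‖velocity T x t‖ ^ 2 / 2 + 1 / ‖x t‖)) + (∫ t in Icc 0 T, U t (x t)) ≤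
      (∫ s in Icc 0 T, (‖velocity T x s‖ ^ 2 / 2 / (1 + ε * deriv φ s) +
        (1 + ε * deriv φ s) * (1 / ‖x s‖))) +
      ∫ s in Icc 0 T, (1 + ε * deriv φ s) * U (s + ε * φ s) (x s) := by
  have hφd : ∀ s, HasDerivAt φ (deriv φ s) s := fun s =>
    (hφ.1.differentiable (by simp) s).hasDerivAt
  have hφ' : Continuous (deriv φ) := hφ.1.continuous_deriv (by simp)
  obtain ⟨M, -, hM, -⟩ := hφ.exists_bound
  have hb : ∀ s, -(|ε| * M) ≤ ε * φ s ∧ ε * φ s ≤ |ε| * M := fun s => by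
    rw [← abs_le, abs_mul]
    exact mul_le_mul_of_nonneg_left (hM s) (abs_nonneg ε)
  have hcont : Continuous fun s => s + ε * φ s :=
    continuous_id.add (continuous_const.mul hφ.1.continuous)
  have hsurj : Function.Surjective fun s => s + ε * φ s := by
    refine hcont.surjective ?_ ?_
    · exact Filter.tendsto_atTop_mono (fun s => by simp only [id_eq]; linarith [(hb s).1])
        (Filter.tendsto_atTop_add_const_right _ (-(|ε| * M)) Filter.tendsto_id)
    · exact Filter.tendsto_atBot_mono (fun s => by simp only [id_eq]; linarith [(hb s).2])
        (Filter.tendsto_atBot_add_const_right _ (|ε| * M) Filter.tendsto_id)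
  have h0 : φ 0 = 0 := hφ.eq_zero (by simp)
  have h1 : φ T = 0 := hφ.eq_zero (by simp)
  obtain ⟨y, hy, hyσ, hyA⟩ := exists_reparametrized_loop hT (U := U) hx.1 hne hP
    (σ := fun s => s + ε * φ s) (σ' := fun s => 1 + ε * deriv φ s)
    (fun s => (hasDerivAt_id s).add ((hφd s).const_mul ε))
    (continuous_const.add (continuous_const.mul hφ'))
    (fun s => by linarith [(abs_le.1 (hε s)).1]) (fun s => by linarith [(abs_le.1 (hε s)).2])
    hsurj (by simp [h0]) (by simp [h1])
  have hyc : y ∈ admissibleLoops T := by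
    obtain ⟨t₀, ht₀, hx0⟩ := hx.2
    have hmono : StrictMono fun s => s + ε * φ s := strictMono_of_deriv_pos fun s => by
      rw [((hasDerivAt_id' s).fun_add ((hφd s).const_mul ε)).deriv]
      linarith [(abs_le.1 (hε s)).1]
    refine Or.inl ⟨hy, t₀ + ε * φ t₀, ?_, by rw [hyσ t₀, hx0]⟩
    have l := hmono.monotone ht₀.1
    have r := hmono.monotone ht₀.2
    simp only [h0, h1, mul_zero, add_zero] at l r
    exact ⟨l, r⟩
  have := hmin hyc
  simp only [mem_ofPred_eq] at this
  rw [hyA, action_eq_of_ae_ne_zero hT hx.1 hne hP] at this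
  exact_mod_cast this

/-- The first variation of the action with respect to the independent variable vanishes. -/
theorem integral_inner_variation_eq_zero {T : ℝ} (hT : 0 < T) {U : ℝ → Plane → ℝ}
    (hU : ContDiff ℝ 1 (fun p : ℝ × Plane => U p.1 p.2))
    {x : ℝ → Plane} (hx : x ∈ collisionLoops T)
    (hmin : IsMinOn (action T U) (admissibleLoops T) x)
    (hne : ∀ᵐ t, t ∈ Icc 0 T → x t ≠ 0)
    (hP : IntegrableOn (fun t => 1 / ‖x t‖) (Icc 0 T)) {φ : ℝ → ℝ} (hφ : IsTestFunction T φ) :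
    ∫ t in Icc 0 T, (-(‖velocity T x t‖ ^ 2 / 2 * deriv φ t) + deriv φ t * (1 / ‖x t‖) +
      (deriv φ t * U t (x t) +
        fderiv ℝ (fun p : ℝ × Plane => U p.1 p.2) (t, x t) (1, 0) * φ t)) = 0 := by
  set W : ℝ × Plane → ℝ := fun p => U p.1 p.2 with hW
  have hK := integrableOn_kinetic hT hx.1
  have hxc : ContinuousOn x (Icc 0 T) := hx.1.1
  have hφc := hφ.1.continuous
  have hφ' : Continuous (deriv φ) := hφ.1.continuous_deriv (by simp)
  have hDc : Continuous (fderiv ℝ W) := hU.continuous_fderiv one_ne_zero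
  have hWc : Continuous W := hU.continuous
  obtain ⟨M, hM0, hM, hM'⟩ := hφ.exists_bound
  -- For `|ε| < δ` the derivative `1 + ε φ'` lies between `1/2` and `3/2`.
  set δ : ℝ := 1 / (2 * M) with hδ
  have hδ0 : 0 < δ := by positivity
  have hsmall : ∀ ε ∈ Metric.ball (0 : ℝ) δ, ∀ t, |ε * deriv φ t| ≤ 1 / 2 := by
    intro ε hε t
    rw [Metric.mem_ball, dist_zero_right, Real.norm_eq_abs] at hε
    rw [abs_mul]
    calc |ε| * |deriv φ t| ≤ δ * M := mul_le_mul hε.le (hM' t) (abs_nonneg _) hδ0.le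
      _ = 1 / 2 := by rw [hδ]; field_simp
  -- After the change of variables only the time argument of `U` depends on `ε`; the position
  -- remains `x(s)`.
  let p : ℝ × ℝ → ℝ × Plane := fun q => (q.2 + q.1 * φ q.2, x q.2)
  have hpc : ContinuousOn p (univ ×ˢ Icc 0 T) :=
    ContinuousOn.prodMk (by fun_prop) (hxc.comp continuousOn_snd fun q hq => hq.2)
  let V : ℝ × ℝ → ℝ := fun q => (1 + q.1 * deriv φ q.2) * W (p q)
  let V' : ℝ × ℝ → ℝ := fun q => deriv φ q.2 * W (p q) +
    (1 + q.1 * deriv φ q.2) * (fderiv ℝ W (p q) (1, 0) * φ q.2)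
  have hVc : ContinuousOn V (univ ×ˢ Icc 0 T) :=
    ContinuousOn.mul (by fun_prop) (hWc.comp_continuousOn hpc)
  have hV'c : ContinuousOn V' (univ ×ˢ Icc 0 T) :=
    (ContinuousOn.mul (by fun_prop) (hWc.comp_continuousOn hpc)).add
      (ContinuousOn.mul (by fun_prop) (((hDc.comp_continuousOn hpc).clm_apply
        continuousOn_const).mul (by fun_prop)))
  have hline : ∀ {Z : ℝ × ℝ → ℝ}, ContinuousOn Z (univ ×ˢ Icc 0 T) → ∀ ε,
      ContinuousOn (fun t => Z (ε, t)) (Icc 0 T) := fun hZ ε =>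
    hZ.comp (by fun_prop) fun t ht => ⟨mem_univ _, ht⟩
  obtain ⟨B, hB⟩ := ((isCompact_closedBall (0 : ℝ) δ).prod
    (isCompact_Icc (a := (0 : ℝ)) (b := T))).exists_bound_of_continuousOn
      (hV'c.mono (prod_mono (subset_univ _) subset_rfl))
  let J : ℝ → ℝ → ℝ := fun ε t => (‖velocity T x t‖ ^ 2 / 2 / (1 + ε * deriv φ t) +
    (1 + ε * deriv φ t) * (1 / ‖x t‖)) + V (ε, t)
  let J' : ℝ → ℝ → ℝ := fun ε t => (-(‖velocity T x t‖ ^ 2 / 2 * deriv φ t) /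
    (1 + ε * deriv φ t) ^ 2 + deriv φ t * (1 / ‖x t‖)) + V' (ε, t)
  have hden : ∀ ε ∈ Metric.ball (0 : ℝ) δ, ∀ t, 1 / 2 ≤ 1 + ε * deriv φ t := fun ε hε t => by
    linarith [(abs_le.1 (hsmall ε hε t)).1]
  have hint1 : ∀ ε ∈ Metric.ball (0 : ℝ) δ, IntegrableOn (fun t =>
      ‖velocity T x t‖ ^ 2 / 2 / (1 + ε * deriv φ t) +
      (1 + ε * deriv φ t) * (1 / ‖x t‖)) (Icc 0 T) := by
    intro ε hε
    refine Integrable.add ?_ ?_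
    · have hc : Continuous fun t => (1 + ε * deriv φ t)⁻¹ :=
        Continuous.inv₀ (by fun_prop) fun t => by linarith [hden ε hε t]
      simp only [div_eq_mul_inv _ (1 + ε * deriv φ _)]
      refine Integrable.mul_bdd (c := 2) hK hc.aestronglyMeasurable
        (Filter.Eventually.of_forall fun t => ?_)
      have := hden ε hε t
      rw [norm_inv, Real.norm_eq_abs, abs_of_pos (by linarith)]
      rw [inv_le_comm₀ (by linarith) two_pos]
      linarith
    · refine Integrable.bdd_mul (c := 2) hP (by fun_prop)
        (Filter.Eventually.of_forall fun t => ?_)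
      rw [Real.norm_eq_abs, abs_of_pos (by linarith [hden ε hε t])]
      linarith [(abs_le.1 (hsmall ε hε t)).2]
  have hint2 : ∀ ε, IntegrableOn (fun t => V (ε, t)) (Icc 0 T) := fun ε =>
    (hline hVc ε).integrableOn_compact isCompact_Icc
  have h0 : (0 : ℝ) ∈ Metric.ball (0 : ℝ) δ := Metric.mem_ball_self hδ0
  -- Differentiation under the integral sign; the factor `4` bounds `1 / (1 + ε φ')²`.
  have hD := hasDerivAt_integral_of_dominated_loc_of_deriv_le
    (μ := volume.restrict (Icc 0 T)) (F := J) (F' := J') (x₀ := (0 : ℝ))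
    (bound := fun t => (4 * M * (‖velocity T x t‖ ^ 2 / 2) + M * (1 / ‖x t‖)) + B)
    (Metric.ball_mem_nhds 0 hδ0) ?_ ((hint1 0 h0).add (hint2 0)) ?_ ?_ ?_ ?_
  · have hlm : IsLocalMin (fun ε => ∫ t in Icc 0 T, J ε t) 0 := by
      filter_upwards [Metric.ball_mem_nhds (0 : ℝ) hδ0] with ε hε
      have := action_le_of_reparametrization hT hx hmin hne hP hφ (hsmall ε hε)
      have e : ∀ ε ∈ Metric.ball (0 : ℝ) δ, ∫ t in Icc 0 T, J ε t =
        (∫ t in Icc 0 T, (‖velocity T x t‖ ^ 2 / 2 / (1 + ε * deriv φ t) +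
          (1 + ε * deriv φ t) * (1 / ‖x t‖))) + ∫ t in Icc 0 T, V (ε, t) := fun ε hε =>
        integral_add (hint1 ε hε) (hint2 ε)
      rw [e ε hε, e 0 h0]
      simpa [V, p, W] using this
    have := hlm.hasDerivAt_eq_zero hD.2
    simpa [J', V', p, W] using this
  · filter_upwards [Metric.ball_mem_nhds (0 : ℝ) hδ0] with ε hε
    exact ((hint1 ε hε).add (hint2 ε)).aestronglyMeasurable
  · refine AEStronglyMeasurable.add ?_
      ((hline hV'c 0).aestronglyMeasurable_of_isCompact isCompact_Icc measurableSet_Icc)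
    simp only [zero_mul, add_zero, one_pow, div_one]
    exact (hK.aestronglyMeasurable.mul hφ'.aestronglyMeasurable).neg.add
      (hφ'.aestronglyMeasurable.mul hP.aestronglyMeasurable)
  · refine (ae_restrict_iff' measurableSet_Icc).2 (Filter.Eventually.of_forall fun t ht ε hε => ?_)
    refine (norm_add_le _ _).trans (add_le_add ((norm_add_le _ _).trans (add_le_add ?_ ?_)) ?_)
    · have h1 := hden ε hε t
      have h2 : (1 : ℝ) / 4 ≤ (1 + ε * deriv φ t) ^ 2 := by nlinarith
      rw [norm_div, norm_neg, norm_mul, Real.norm_eq_abs, Real.norm_eq_abs, Real.norm_eq_abs,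
        abs_of_nonneg (by positivity : 0 ≤ ‖velocity T x t‖ ^ 2 / 2), abs_of_nonneg (sq_nonneg (1 + ε * deriv φ t)),
        div_le_iff₀ (by linarith)]
      have h3 : ‖velocity T x t‖ ^ 2 / 2 * |deriv φ t| ≤ ‖velocity T x t‖ ^ 2 / 2 * M :=
        mul_le_mul_of_nonneg_left (hM' t) (by positivity)
      have h4 : 0 ≤ 4 * M * (‖velocity T x t‖ ^ 2 / 2) := by positivity
      nlinarith
    · rw [norm_mul, Real.norm_eq_abs, Real.norm_eq_abs,
        abs_of_nonneg (by positivity : 0 ≤ 1 / ‖x t‖)]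
      exact mul_le_mul_of_nonneg_right (hM' t) (by positivity)
    · exact hB (ε, t) ⟨Metric.ball_subset_closedBall hε, ht⟩
  · refine Integrable.add ((hK.const_mul _).add (hP.const_mul M)) (integrable_const B)
  · refine Filter.Eventually.of_forall fun t ε hε => ?_
    have h1 : HasDerivAt (fun ε => 1 + ε * deriv φ t) (deriv φ t) ε := by
      simpa using ((hasDerivAt_id ε).mul_const (deriv φ t)).const_add 1
    have h2 : HasDerivAt (fun ε => p (ε, t)) (φ t, 0) ε := by
      refine HasDerivAt.prodMk ?_ (hasDerivAt_const ε (x t))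
      simpa using ((hasDerivAt_id ε).mul_const (φ t)).const_add t
    have hWd : HasFDerivAt W (fderiv ℝ W (p (ε, t))) (p (ε, t)) :=
      ((hU.differentiable one_ne_zero) (p (ε, t))).hasFDerivAt
    have h3 : HasDerivAt (fun ε => W (p (ε, t))) (fderiv ℝ W (p (ε, t)) (φ t, 0)) ε := by
      have := hWd.comp_hasDerivAt ε h2
      exact this
    have h4 : fderiv ℝ W (p (ε, t)) (φ t, 0) = fderiv ℝ W (p (ε, t)) (1, 0) * φ t := by
      have : ((φ t, 0) : ℝ × Plane) = φ t • (1, 0) := by simp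
      rw [this, map_smul, smul_eq_mul, mul_comm]
    rw [h4] at h3
    have hd : 1 + ε * deriv φ t ≠ 0 := by linarith [hden ε hε t]
    have h5 := (((hasDerivAt_const ε (‖velocity T x t‖ ^ 2 / 2)).fun_div h1 hd).fun_add
      (h1.mul_const (1 / ‖x t‖))).fun_add (h1.fun_mul h3)
    convert h5 using 1
    simp only [J', V']
    ring

/-- The energy is integrable, and its distributional derivative is the power of the force. -/
theorem hasWeakDeriv_energy {T : ℝ} (hT : 0 < T) {U : ℝ → Plane → ℝ}
    (hU : ContDiff ℝ 1 (fun p : ℝ × Plane => U p.1 p.2))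
    {x : ℝ → Plane} (hx : x ∈ collisionLoops T)
    (hmin : IsMinOn (action T U) (admissibleLoops T) x)
    (hne : ∀ᵐ t, t ∈ Icc 0 T → x t ≠ 0)
    (hP : IntegrableOn (fun t => 1 / ‖x t‖) (Icc 0 T)) :
    IntegrableOn (energy T x) (Icc 0 T) ∧
    IntegrableOn (fun t => inner ℝ (gradient (U t) (x t)) (velocity T x t)) (Icc 0 T) ∧
    HasWeakDeriv T (energy T x)
      (fun t => inner ℝ (gradient (U t) (x t)) (velocity T x t)) := by
  set W : ℝ × Plane → ℝ := fun p => U p.1 p.2 with hW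
  have hK := integrableOn_kinetic hT hx.1
  have hxc : ContinuousOn x (Icc 0 T) := hx.1.1
  have hDc : Continuous (fderiv ℝ W) := hU.continuous_fderiv one_ne_zero
  have hE : IntegrableOn (energy T x) (Icc 0 T) := hK.sub hP
  have hpr := isPrimitive_velocity hT hx.1
  have hv : Integrable (velocity T x) (volume.restrict (Icc 0 T)) :=
    (intervalIntegrable_iff_integrableOn_Icc_of_le hT.le).1 hpr.integrable
  have hDx : ContinuousOn (fun t => fderiv ℝ W (t, x t)) (Icc 0 T) :=
    hDc.comp_continuousOn (continuousOn_id.prodMk hxc)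
  have hG : IntegrableOn (fun t => inner ℝ (gradient (U t) (x t)) (velocity T x t))
      (Icc 0 T) := by
    simp only [inner_gradient_eq hU]
    exact integrableOn_clm_apply hDx
      (show Integrable (fun t => ((0 : ℝ), velocity T x t)) (volume.restrict (Icc 0 T)) from
        Integrable.prodMk (integrable_zero _ _ _) hv)
  refine ⟨hE, hG, (hE.mono_set Ioo_subset_Icc_self).locallyIntegrableOn,
    (hG.mono_set Ioo_subset_Icc_self).locallyIntegrableOn, fun φ hφ => ?_⟩
  have hφ' : Continuous (deriv φ) := hφ.1.continuous_deriv (by simp)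
  have hr : volume.restrict (Ioo 0 T) = volume.restrict (Icc 0 T) :=
    Measure.restrict_congr_set Ioo_ae_eq_Icc
  rw [hr]
  have hvar := integral_inner_variation_eq_zero hT hU hx hmin hne hP hφ
  -- Combined with the vanishing first variation, this cancels the terms in `∂ₜU` and leaves only
  -- the power of the force.
  have hparts := (isPrimitive_potential hU hT.le hpr).integral_deriv_smul hT.le
    (hφ.1.of_le (by simp)) (hφ.eq_zero (by simp)) (hφ.eq_zero (by simp))
  rw [intervalIntegral.integral_of_le hT.le, intervalIntegral.integral_of_le hT.le,
    ← integral_Icc_eq_integral_Ioc, ← integral_Icc_eq_integral_Ioc] at hparts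
  obtain ⟨M, hM0, hM, hM'⟩ := hφ.exists_bound
  have hmul : ∀ {ψ : ℝ → ℝ}, Continuous ψ → (∀ t, |ψ t| ≤ M) → ∀ {u : ℝ → ℝ},
      IntegrableOn u (Icc 0 T) → IntegrableOn (fun t => ψ t * u t) (Icc 0 T) :=
    fun hψ hψM _ hu => Integrable.bdd_mul (c := M) hu hψ.aestronglyMeasurable
      (Filter.Eventually.of_forall hψM)
  have hUi : IntegrableOn (fun t => U t (x t)) (Icc 0 T) :=
    (hU.continuous.comp_continuousOn
      (continuousOn_id.prodMk hxc)).integrableOn_compact isCompact_Icc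
  have hti : IntegrableOn (fun t => fderiv ℝ W (t, x t) (1, 0)) (Icc 0 T) :=
    (hDx.clm_apply continuousOn_const).integrableOn_compact isCompact_Icc
  have i1 := hmul hφ' hM' hE
  have i2 := hmul hφ' hM' hUi
  have i3 := hmul hφ.1.continuous hM hti
  have i4 := hmul hφ.1.continuous hM hG
  have e1 : ∫ t in Icc 0 T, φ t • fderiv ℝ W (t, x t) (1, velocity T x t) =
      (∫ t in Icc 0 T, φ t * fderiv ℝ W (t, x t) (1, 0)) +
        ∫ t in Icc 0 T, φ t * inner ℝ (gradient (U t) (x t)) (velocity T x t) := by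
    rw [← integral_add i3 i4]
    refine integral_congr_ae (Filter.Eventually.of_forall fun t => ?_)
    have : ((1 : ℝ), velocity T x t) = (1, 0) + (0, velocity T x t) := by simp
    simp only [this, map_add, inner_gradient_eq hU, smul_eq_mul, hW]
    ring
  have e2 : (0 : ℝ) = -(∫ t in Icc 0 T, deriv φ t * energy T x t) +
      ((∫ t in Icc 0 T, deriv φ t * U t (x t)) +
        ∫ t in Icc 0 T, φ t * fderiv ℝ W (t, x t) (1, 0)) := by
    rw [← integral_add i2 i3, ← integral_neg, ← integral_add i1.fun_neg (i2.fun_add i3)]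
    refine hvar.symm.trans ?_
    refine integral_congr_ae (Filter.Eventually.of_forall fun t => ?_)
    simp only [energy]
    ring
  rw [e1] at hparts
  simp only [smul_eq_mul] at hparts ⊢
  linarith

/-! ### Variations of the dependent variable -/

theorem hasDerivAt_one_div_norm_line {a b : Plane} {ε : ℝ} (h : a + ε • b ≠ 0) :
    HasDerivAt (fun r : ℝ => 1 / ‖a + r • b‖)
      (-(inner ℝ (a + ε • b) b / ‖a + ε • b‖ ^ 3)) ε := by
  have hl : HasDerivAt (fun r : ℝ => a + r • b) b ε := by
    simpa using ((hasDerivAt_id ε).smul_const b).const_add a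
  have hn : 0 < ‖a + ε • b‖ := norm_pos_iff.2 h
  have hs := (hl.norm_sq.sqrt (by positivity)).fun_inv (by
    rw [Real.sqrt_sq hn.le]
    exact hn.ne')
  simp only [Real.sqrt_sq (norm_nonneg _)] at hs
  simp only [one_div]
  refine hs.congr_deriv ?_
  field_simp

/-- The force acting on a particle at the point `x t`. -/
noncomputable def force (U : ℝ → Plane → ℝ) (x : ℝ → Plane) (t : ℝ) : Plane :=
  -((‖x t‖ ^ 3)⁻¹ • x t) + gradient (U t) (x t)

theorem continuousOn_force {U : ℝ → Plane → ℝ}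
    (hU : ContDiff ℝ 1 (fun p : ℝ × Plane => U p.1 p.2)) {x : ℝ → Plane} {s : Set ℝ}
    (hx : ContinuousOn x s) (hne : ∀ t ∈ s, x t ≠ 0) : ContinuousOn (force U x) s := by
  refine ContinuousOn.add (((hx.norm.pow 3).inv₀ fun t ht => ?_).smul hx).neg ?_
  · exact pow_ne_zero _ (norm_ne_zero_iff.2 (hne t ht))
  · have e : ∀ t, gradient (U t) (x t) = (InnerProductSpace.toDual ℝ Plane).symm
        ((fderiv ℝ (fun p : ℝ × Plane => U p.1 p.2) (t, x t)).comp
          (ContinuousLinearMap.inr ℝ ℝ Plane)) := fun t => by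
      refine ext_inner_right ℝ fun v => ?_
      rw [inner_gradient_eq hU, InnerProductSpace.toDual_symm_apply]
      simp
    simp only [e]
    refine (InnerProductSpace.toDual ℝ Plane).symm.continuous.comp_continuousOn ?_
    exact ((hU.continuous_fderiv one_ne_zero).comp_continuousOn
      (continuousOn_id.prodMk hx)).clm_comp continuousOn_const

section Variation

variable {T : ℝ} {U : ℝ → Plane → ℝ} {x : ℝ → Plane} {φ : ℝ → ℝ}

/-- Compactness of the support leaves a margin `m`, so that small perturbations create no new
collision. -/
theorem exists_pos_le_norm_of_test (hx : ContinuousOn x (Icc 0 T)) (hφ : IsTestFunction T φ)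
    (hφx : ∀ t ∈ tsupport φ, x t ≠ 0) : ∃ m, 0 < m ∧ ∀ t, φ t ≠ 0 → m ≤ ‖x t‖ := by
  rcases (tsupport φ).eq_empty_or_nonempty with h | h
  · exact ⟨1, one_pos, fun t ht => absurd (subset_tsupport φ ht) (by simp [h])⟩
  · have hc : ContinuousOn (fun t => ‖x t‖) (tsupport φ) :=
      (hx.mono (hφ.2.2.trans Ioo_subset_Icc_self)).norm
    obtain ⟨t₀, ht₀, hm⟩ := hφ.2.1.isCompact.exists_isMinOn h hc
    exact ⟨‖x t₀‖, norm_pos_iff.2 (hφx t₀ ht₀), fun t ht => hm (subset_tsupport φ ht)⟩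

/-- The perturbation vanishes at every collision of `x`, so the perturbed loop still collides and is
admissible. Where `φ` vanishes, `1/|x|` is unchanged; elsewhere the new term is at most `1/m`. -/
theorem action_le_of_variation (hT : 0 < T) (hx : x ∈ collisionLoops T)
    (hmin : IsMinOn (action T U) (admissibleLoops T) x)
    (hne : ∀ᵐ t, t ∈ Icc 0 T → x t ≠ 0)
    (hP : IntegrableOn (fun t => 1 / ‖x t‖) (Icc 0 T)) (hφ : IsTestFunction T φ)
    (hφx : ∀ t ∈ tsupport φ, x t ≠ 0) {m : ℝ} (hm : 0 < m) {ε : ℝ} {e : Plane}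
    (hlow : ∀ t, φ t ≠ 0 → m ≤ ‖x t + ε • φ t • e‖) :
    IntegrableOn (fun t => ‖velocity T x t + ε • deriv φ t • e‖ ^ 2 / 2) (Icc 0 T) ∧
    IntegrableOn (fun t => 1 / ‖x t + ε • φ t • e‖) (Icc 0 T) ∧
    (∫ t in Icc 0 T, (‖velocity T x t‖ ^ 2 / 2 + 1 / ‖x t‖)) + (∫ t in Icc 0 T, U t (x t)) ≤
      (∫ t in Icc 0 T, (‖velocity T x t + ε • deriv φ t • e‖ ^ 2 / 2 +
        1 / ‖x t + ε • φ t • e‖)) + ∫ t in Icc 0 T, U t (x t + ε • φ t • e) := by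
  have hφd : ∀ s, HasDerivAt φ (deriv φ s) s := fun s =>
    (hφ.1.differentiable (by simp) s).hasDerivAt
  have hφ' : Continuous (deriv φ) := hφ.1.continuous_deriv (by simp)
  have hφc := hφ.1.continuous
  let w : ℝ → Plane := fun t => ε • φ t • e
  let w' : ℝ → Plane := fun t => ε • deriv φ t • e
  have hwc : Continuous w := by fun_prop
  have hw'c : Continuous w' := by fun_prop
  have hw : ∀ t, HasDerivAt w (w' t) t := fun t => ((hφd t).smul_const e).const_smul ε
  have hprim := isPrimitive_velocity hT hx.1
  have hw0 : w 0 = 0 := by simp [w, hφ.eq_zero (t := 0) (by simp)]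
  have hwT : w T = 0 := by simp [w, hφ.eq_zero (t := T) (by simp)]
  have hpy : IsPrimitive 0 T (fun t => x t + w t) (fun t => velocity T x t + w' t) := by
    refine ⟨hprim.integrable.add (hw'c.intervalIntegrable _ _), fun t ht => ?_⟩
    rw [intervalIntegral.integral_add (hprim.intervalIntegrable ⟨le_rfl, hT.le⟩ ht)
      (hw'c.intervalIntegrable _ _), intervalIntegral.integral_eq_sub_of_hasDerivAt
      (fun s _ => hw s) (hw'c.intervalIntegrable _ _), hprim.eq_add t ht, hw0]
    abel
  have hLp : MemLp (fun t => velocity T x t + w' t) 2 (volume.restrict (Icc 0 T)) := by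
    refine (memLp_velocity hT hx.1).add ?_
    obtain ⟨M, hM⟩ := isCompact_Icc.exists_bound_of_continuousOn (s := Icc 0 T) hw'c.continuousOn
    exact MemLp.of_bound hw'c.aestronglyMeasurable M
      ((ae_restrict_iff' measurableSet_Icc).2 (Filter.Eventually.of_forall hM))
  have hyH : (fun t => x t + w t) ∈ HOneLoops T :=
    mem_HOneLoops_of_isPrimitive hT hpy hLp (by simp [hw0, hwT, hx.1.2.2])
  have hyc : (fun t => x t + w t) ∈ admissibleLoops T := by
    obtain ⟨t₀, ht₀, hx0⟩ := hx.2
    refine Or.inl ⟨hyH, t₀, ht₀, ?_⟩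
    have : φ t₀ = 0 := image_eq_zero_of_notMem_tsupport fun h => hφx t₀ h hx0
    simp [w, this, hx0]
  have hney : ∀ᵐ t, t ∈ Icc 0 T → x t + w t ≠ 0 := by
    filter_upwards [hne] with t ht hmt
    by_cases h : φ t = 0
    · simpa [w, h] using ht hmt
    · exact norm_pos_iff.1 (hm.trans_le (hlow t h))
  have hPy : IntegrableOn (fun t => 1 / ‖x t + w t‖) (Icc 0 T) := by
    have hym : AEMeasurable (fun t => x t + w t) (volume.restrict (Icc 0 T)) :=
      hyH.1.aemeasurable measurableSet_Icc
    refine Integrable.mono' (hP.add (integrable_const (1 / m))) ?_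
      (Filter.Eventually.of_forall fun t => ?_)
    · simp only [one_div]
      exact hym.norm.inv.aestronglyMeasurable
    · simp only [Pi.add_apply]
      rw [Real.norm_eq_abs, abs_of_nonneg (by positivity)]
      by_cases h : φ t = 0
      · simp only [w, h, zero_smul, smul_zero, add_zero, le_add_iff_nonneg_right]
        positivity
      · have : 1 / ‖x t + w t‖ ≤ 1 / m := one_div_le_one_div_of_le hm (hlow t h)
        have : 0 ≤ 1 / ‖x t‖ := by positivity
        linarith
  refine ⟨((memLp_two_iff_integrable_sq_norm hLp.aestronglyMeasurable).1 hLp).div_const 2,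
    hPy, ?_⟩
  have := hmin hyc
  simp only [mem_ofPred_eq] at this
  rw [action_eq_of_ae_ne_zero hT hx.1 hne hP, action_eq_of_ae_ne_zero hT hyH hney hPy] at this
  have e1 : ∫ t in Icc 0 T, (‖velocity T (fun t => x t + w t) t‖ ^ 2 / 2 + 1 / ‖x t + w t‖) =
      ∫ t in Icc 0 T, (‖velocity T x t + w' t‖ ^ 2 / 2 + 1 / ‖x t + w t‖) := by
    refine integral_congr_ae ((ae_restrict_iff' measurableSet_Icc).2 ?_)
    filter_upwards [velocity_ae_eq hT hpy] with t ht hmt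
    simp only [ht hmt]
  rw [e1] at this
  exact_mod_cast this

/-- The weak form of the equation of motion, tested away from the collisions. -/
theorem integral_outer_variation_eq_zero (hT : 0 < T)
    (hU : ContDiff ℝ 1 (fun p : ℝ × Plane => U p.1 p.2)) (hx : x ∈ collisionLoops T)
    (hmin : IsMinOn (action T U) (admissibleLoops T) x)
    (hne : ∀ᵐ t, t ∈ Icc 0 T → x t ≠ 0)
    (hP : IntegrableOn (fun t => 1 / ‖x t‖) (Icc 0 T)) (hφ : IsTestFunction T φ)
    (hφx : ∀ t ∈ tsupport φ, x t ≠ 0) (e : Plane) :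
    ∫ t in Icc 0 T, inner ℝ (deriv φ t • velocity T x t + φ t • force U x t) e = 0 := by
  set W : ℝ × Plane → ℝ := fun p => U p.1 p.2 with hW
  have hK := integrableOn_kinetic hT hx.1
  have hxc : ContinuousOn x (Icc 0 T) := hx.1.1
  have hφc := hφ.1.continuous
  have hφ' : Continuous (deriv φ) := hφ.1.continuous_deriv (by simp)
  have hDc : Continuous (fderiv ℝ W) := hU.continuous_fderiv one_ne_zero
  have hWc : Continuous W := hU.continuous
  obtain ⟨M, hM0, hM, hM'⟩ := hφ.exists_bound
  obtain ⟨m, hm0, hm⟩ := exists_pos_le_norm_of_test hxc hφ hφx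
  -- Ensures `|ε φ e| ≤ m/2`; the `+ 1` keeps the denominator positive when `e = 0`.
  set δ : ℝ := m / (2 * (M * (‖e‖ + 1))) with hδ
  have hδ0 : 0 < δ := by positivity
  have hφe : ∀ t, ‖φ t • e‖ ≤ M * ‖e‖ := fun t => by
    rw [norm_smul, Real.norm_eq_abs]
    exact mul_le_mul_of_nonneg_right (hM t) (norm_nonneg e)
  have hφ'e : ∀ t, ‖deriv φ t • e‖ ≤ M * ‖e‖ := fun t => by
    rw [norm_smul, Real.norm_eq_abs]
    exact mul_le_mul_of_nonneg_right (hM' t) (norm_nonneg e)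
  have hball : ∀ ε ∈ Metric.ball (0 : ℝ) δ, |ε| ≤ δ := fun ε hε => by
    rw [Metric.mem_ball, dist_zero_right, Real.norm_eq_abs] at hε
    exact hε.le
  have hlow : ∀ ε ∈ Metric.ball (0 : ℝ) δ, ∀ t, φ t ≠ 0 → m / 2 ≤ ‖x t + ε • φ t • e‖ := by
    intro ε hε t ht
    have h1 : ‖ε • φ t • e‖ ≤ m / 2 := by
      rw [norm_smul, Real.norm_eq_abs]
      calc |ε| * ‖φ t • e‖ ≤ δ * (M * (‖e‖ + 1)) :=
            mul_le_mul (hball ε hε) ((hφe t).trans (by nlinarith)) (norm_nonneg _) hδ0.le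
        _ = m / 2 := by rw [hδ]; field_simp
    have h2 := norm_sub_le (x t + ε • φ t • e) (ε • φ t • e)
    rw [add_sub_cancel_right] at h2
    linarith [hm t ht]
  let p : ℝ × ℝ → ℝ × Plane := fun q => (q.2, x q.2 + q.1 • φ q.2 • e)
  have hpc : ContinuousOn p (univ ×ˢ Icc 0 T) :=
    ContinuousOn.prodMk (by fun_prop) ((hxc.comp continuousOn_snd fun q hq => hq.2).add
      (by fun_prop))
  let V : ℝ × ℝ → ℝ := fun q => W (p q)
  let V' : ℝ × ℝ → ℝ := fun q => fderiv ℝ W (p q) (0, φ q.2 • e)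
  have hVc : ContinuousOn V (univ ×ˢ Icc 0 T) := hWc.comp_continuousOn hpc
  have hV'c : ContinuousOn V' (univ ×ˢ Icc 0 T) :=
    (hDc.comp_continuousOn hpc).clm_apply (by fun_prop)
  have hline : ∀ {Z : ℝ × ℝ → ℝ}, ContinuousOn Z (univ ×ˢ Icc 0 T) → ∀ ε,
      ContinuousOn (fun t => Z (ε, t)) (Icc 0 T) := fun hZ ε =>
    hZ.comp (by fun_prop) fun t ht => ⟨mem_univ _, ht⟩
  obtain ⟨B, hB⟩ := ((isCompact_closedBall (0 : ℝ) δ).prod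
    (isCompact_Icc (a := (0 : ℝ)) (b := T))).exists_bound_of_continuousOn
      (hV'c.mono (prod_mono (subset_univ _) subset_rfl))
  let J : ℝ → ℝ → ℝ := fun ε t => (‖velocity T x t + ε • deriv φ t • e‖ ^ 2 / 2 +
    1 / ‖x t + ε • φ t • e‖) + V (ε, t)
  let J' : ℝ → ℝ → ℝ := fun ε t => (inner ℝ (velocity T x t + ε • deriv φ t • e) (deriv φ t • e) +
    -(inner ℝ (x t + ε • φ t • e) (φ t • e) / ‖x t + ε • φ t • e‖ ^ 3)) + V' (ε, t)
  have hvar := fun ε (hε : ε ∈ Metric.ball (0 : ℝ) δ) =>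
    action_le_of_variation hT hx hmin hne hP hφ hφx (half_pos hm0) (hlow ε hε)
  have hint1 : ∀ ε ∈ Metric.ball (0 : ℝ) δ, IntegrableOn (fun t =>
      ‖velocity T x t + ε • deriv φ t • e‖ ^ 2 / 2 + 1 / ‖x t + ε • φ t • e‖) (Icc 0 T) :=
    fun ε hε => (hvar ε hε).1.add (hvar ε hε).2.1
  have hint2 : ∀ ε, IntegrableOn (fun t => V (ε, t)) (Icc 0 T) := fun ε =>
    (hline hVc ε).integrableOn_compact isCompact_Icc
  have h0 : (0 : ℝ) ∈ Metric.ball (0 : ℝ) δ := Metric.mem_ball_self hδ0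
  have hv : Integrable (velocity T x) (volume.restrict (Icc 0 T)) :=
    (memLp_velocity hT hx.1).integrable (by norm_num)
  have hxm : AEMeasurable x (volume.restrict (Icc 0 T)) := hxc.aemeasurable measurableSet_Icc
  have hD := hasDerivAt_integral_of_dominated_loc_of_deriv_le
    (μ := volume.restrict (Icc 0 T)) (F := J) (F' := J') (x₀ := (0 : ℝ))
    (bound := fun t => ((‖velocity T x t‖ + δ * (M * ‖e‖)) * (M * ‖e‖) +
      M * ‖e‖ / (m / 2) ^ 2) + B)
    (Metric.ball_mem_nhds 0 hδ0) ?_ ((hint1 0 h0).add (hint2 0)) ?_ ?_ ?_ ?_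
  · have hlm : IsLocalMin (fun ε => ∫ t in Icc 0 T, J ε t) 0 := by
      filter_upwards [Metric.ball_mem_nhds (0 : ℝ) hδ0] with ε hε
      have := (hvar ε hε).2.2
      have e : ∀ ε ∈ Metric.ball (0 : ℝ) δ, ∫ t in Icc 0 T, J ε t =
        (∫ t in Icc 0 T, (‖velocity T x t + ε • deriv φ t • e‖ ^ 2 / 2 +
          1 / ‖x t + ε • φ t • e‖)) + ∫ t in Icc 0 T, V (ε, t) := fun ε hε =>
        integral_add (hint1 ε hε) (hint2 ε)
      rw [e ε hε, e 0 h0]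
      simpa [V, p, W] using this
    refine Eq.trans ?_ (hlm.hasDerivAt_eq_zero hD.2)
    refine integral_congr_ae (Filter.Eventually.of_forall fun t => ?_)
    simp only [J', V', p, force, zero_smul, add_zero, inner_add_left, inner_smul_left,
      inner_neg_left, inner_gradient_eq hU, inner_smul_right, conj_trivial]
    have : ((0, φ t • e) : ℝ × Plane) = φ t • (0, e) := by simp
    rw [this, map_smul, smul_eq_mul]
    ring
  · filter_upwards [Metric.ball_mem_nhds (0 : ℝ) hδ0] with ε hε
    exact ((hint1 ε hε).add (hint2 ε)).aestronglyMeasurable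
  · refine AEStronglyMeasurable.add ?_
      ((hline hV'c 0).aestronglyMeasurable_of_isCompact isCompact_Icc measurableSet_Icc)
    simp only [zero_smul, add_zero]
    refine AEStronglyMeasurable.add (hv.aestronglyMeasurable.inner (by fun_prop)) ?_
    refine AEStronglyMeasurable.neg (AEMeasurable.aestronglyMeasurable ?_)
    exact (hxm.inner (by fun_prop)).div (hxm.norm.pow_const 3)
  · refine (ae_restrict_iff' measurableSet_Icc).2 (Filter.Eventually.of_forall fun t ht ε hε => ?_)
    refine (norm_add_le _ _).trans (add_le_add ((norm_add_le _ _).trans (add_le_add ?_ ?_)) ?_)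
    · refine (norm_inner_le_norm (𝕜 := ℝ) _ _).trans (mul_le_mul ((norm_add_le _ _).trans ?_) (hφ'e t)
        (norm_nonneg _) (by positivity))
      rw [norm_smul, Real.norm_eq_abs]
      exact add_le_add le_rfl (mul_le_mul (hball ε hε) (hφ'e t) (norm_nonneg _) hδ0.le)
    · by_cases h : φ t = 0
      · simp only [h, zero_smul, inner_zero_right, zero_div, neg_zero, norm_zero]
        positivity
      · have hl := hlow ε hε t h
        have hl0 : 0 < ‖x t + ε • φ t • e‖ := (half_pos hm0).trans_le hl
        rw [norm_neg, norm_div, norm_pow, norm_norm, div_le_div_iff₀ (by positivity)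
          (by positivity)]
        calc ‖(inner ℝ (x t + ε • φ t • e) (φ t • e) : ℝ)‖ * (m / 2) ^ 2
            ≤ (‖x t + ε • φ t • e‖ * (M * ‖e‖)) * ‖x t + ε • φ t • e‖ ^ 2 := by
              refine mul_le_mul ((norm_inner_le_norm (𝕜 := ℝ) _ _).trans ?_) ?_ (by positivity)
                (by positivity)
              · exact mul_le_mul_of_nonneg_left (hφe t) (norm_nonneg _)
              · exact pow_le_pow_left₀ (half_pos hm0).le hl 2
          _ = M * ‖e‖ * ‖x t + ε • φ t • e‖ ^ 3 := by ring
    · exact hB (ε, t) ⟨Metric.ball_subset_closedBall hε, ht⟩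
  · exact Integrable.add (Integrable.add ((hv.norm.add (integrable_const _)).mul_const _)
      (integrable_const _)) (integrable_const B)
  · refine Filter.Eventually.of_forall fun t ε hε => ?_
    have h1 : HasDerivAt (fun ε : ℝ => velocity T x t + ε • deriv φ t • e) (deriv φ t • e) ε := by
      simpa using ((hasDerivAt_id ε).smul_const (deriv φ t • e)).const_add (velocity T x t)
    have h2 : HasDerivAt (fun ε => p (ε, t)) (0, φ t • e) ε := by
      refine HasDerivAt.prodMk (hasDerivAt_const ε t) ?_
      simpa using ((hasDerivAt_id ε).smul_const (φ t • e)).const_add (x t)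
    have hWd : HasFDerivAt W (fderiv ℝ W (p (ε, t))) (p (ε, t)) :=
      ((hU.differentiable one_ne_zero) (p (ε, t))).hasFDerivAt
    have h3 : HasDerivAt (fun ε => W (p (ε, t))) (fderiv ℝ W (p (ε, t)) (0, φ t • e)) ε := by
      have := hWd.comp_hasDerivAt ε h2
      exact this
    have h4 : HasDerivAt (fun ε : ℝ => 1 / ‖x t + ε • φ t • e‖)
        (-(inner ℝ (x t + ε • φ t • e) (φ t • e) / ‖x t + ε • φ t • e‖ ^ 3)) ε := by
      -- Where `φ t = 0` the point `x t` may be a collision, but the function is constant in `ε`.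
      by_cases h : φ t = 0
      · simpa [h] using hasDerivAt_const ε (1 / ‖x t‖)
      · exact hasDerivAt_one_div_norm_line
          (norm_pos_iff.1 ((half_pos hm0).trans_le (hlow ε hε t h)))
    have h5 := ((h1.norm_sq.div_const 2).fun_add h4).fun_add h3
    convert h5 using 1
    simp only [J', V']
    ring

end Variation

/-! ### Regularity away from the collisions -/

section Regularity

variable {T : ℝ} {U : ℝ → Plane → ℝ} {x : ℝ → Plane}

/-- The vector identity follows by pairing with each constant `e`. -/
theorem integral_deriv_smul_velocity (hT : 0 < T)
    (hU : ContDiff ℝ 1 (fun p : ℝ × Plane => U p.1 p.2)) (hx : x ∈ collisionLoops T)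
    (hmin : IsMinOn (action T U) (admissibleLoops T) x)
    (hne : ∀ᵐ t, t ∈ Icc 0 T → x t ≠ 0)
    (hP : IntegrableOn (fun t => 1 / ‖x t‖) (Icc 0 T)) {a b : ℝ}
    (hsub : Icc a b ⊆ Icc 0 T) (hab : a < b) (hxab : ∀ t ∈ Icc a b, x t ≠ 0) {φ : ℝ → ℝ}
    (hφ : ContDiff ℝ ∞ φ) (hφc : HasCompactSupport φ) (hφs : tsupport φ ⊆ Ioo a b) :
    ∫ t in Ioo a b, deriv φ t • velocity T x t = -∫ t in Ioo a b, φ t • force U x t := by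
  have ha := hsub (left_mem_Icc.2 hab.le)
  have hb := hsub (right_mem_Icc.2 hab.le)
  have hIoo : Ioo a b ⊆ Icc 0 T := Ioo_subset_Icc_self.trans hsub
  have hφT : IsTestFunction T φ := ⟨hφ, hφc, hφs.trans (Ioo_subset_Ioo ha.1 hb.2)⟩
  have hφx : ∀ t ∈ tsupport φ, x t ≠ 0 := fun t ht => hxab t (Ioo_subset_Icc_self (hφs ht))
  obtain ⟨M, -, hM, hM'⟩ := hφT.exists_bound
  have hv : IntegrableOn (velocity T x) (Icc 0 T) :=
    (memLp_velocity hT hx.1).integrable (by norm_num)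
  have hf : IntegrableOn (force U x) (Icc a b) :=
    (continuousOn_force hU (hx.1.1.mono hsub) hxab).integrableOn_compact isCompact_Icc
  have i1 : Integrable (fun t => deriv φ t • velocity T x t) (volume.restrict (Ioo a b)) :=
    Integrable.bdd_smul (hv.mono_set hIoo) M
      (hφ.continuous_deriv (by simp)).aestronglyMeasurable (Filter.Eventually.of_forall hM')
  have i2 : Integrable (fun t => φ t • force U x t) (volume.restrict (Ioo a b)) :=
    Integrable.bdd_smul (hf.mono_set Ioo_subset_Icc_self) M
      hφ.continuous.aestronglyMeasurable (Filter.Eventually.of_forall hM)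
  rw [eq_neg_iff_add_eq_zero, ← integral_add i1 i2]
  refine ext_inner_left ℝ fun e => ?_
  rw [inner_zero_right, ← integral_inner (i1.fun_add i2)]
  refine Eq.trans ?_ (integral_outer_variation_eq_zero hT hU hx hmin hne hP hφT hφx e)
  simp only [real_inner_comm e]
  refine (setIntegral_eq_of_subset_of_forall_sdiff_eq_zero measurableSet_Icc hIoo
    fun t ht => ?_).symm
  have h1 : φ t = 0 := image_eq_zero_of_notMem_tsupport fun h => ht.2 (hφs h)
  have h2 : deriv φ t = 0 := image_eq_zero_of_notMem_tsupport fun h =>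
    ht.2 (hφs (tsupport_deriv_subset h))
  simp [h1, h2]

theorem exists_continuous_hasDerivWithinAt (hT : 0 < T)
    (hU : ContDiff ℝ 1 (fun p : ℝ × Plane => U p.1 p.2)) (hx : x ∈ collisionLoops T)
    (hmin : IsMinOn (action T U) (admissibleLoops T) x)
    (hne : ∀ᵐ t, t ∈ Icc 0 T → x t ≠ 0)
    (hP : IntegrableOn (fun t => 1 / ‖x t‖) (Icc 0 T)) {a b : ℝ}
    (hsub : Icc a b ⊆ Icc 0 T) (hab : a < b) (hxab : ∀ t ∈ Icc a b, x t ≠ 0) :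
    ∃ w : ℝ → Plane, Continuous w ∧ ∀ t ∈ Icc a b, HasDerivWithinAt x (w t) (Icc a b) t := by
  have hv : IntegrableOn (velocity T x) (Icc 0 T) :=
    (memLp_velocity hT hx.1).integrable (by norm_num)
  have hf : IntegrableOn (force U x) (Icc a b) :=
    (continuousOn_force hU (hx.1.1.mono hsub) hxab).integrableOn_compact isCompact_Icc
  obtain ⟨c, hc⟩ := exists_ae_eq_add_integral hab
    (hv.mono_set (Ioo_subset_Icc_self.trans hsub)) (hf.mono_set Ioo_subset_Icc_self)
    (fun φ h1 h2 h3 => integral_deriv_smul_velocity hT hU hx hmin hne hP hsub hab hxab h1 h2 h3)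
  have hG : IsPrimitive a b (fun t => c + ∫ s in a..t, force U x s) (force U x) :=
    ⟨(intervalIntegrable_iff_integrableOn_Icc_of_le hab.le).2 hf, by simp⟩
  -- A continuous extension to the line lets the fundamental theorem of calculus apply at `a` and
  -- `b` too.
  let w : ℝ → Plane := IccExtend hab.le (fun t : Icc a b => c + ∫ s in a..t, force U x s)
  have hwc : Continuous w := (continuousOn_iff_continuous_domRestrict.1
    (hG.continuousOn hab.le)).Icc_extend'
  have hwe : ∀ t ∈ Icc a b, w t = c + ∫ s in a..t, force U x s := fun t ht =>
    IccExtend_of_mem hab.le _ ht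
  have hpr := (isPrimitive_velocity hT hx.1).mono (hsub (left_mem_Icc.2 hab.le))
    (hsub (right_mem_Icc.2 hab.le))
  have hxe : ∀ t ∈ Icc a b, x t = x a + ∫ s in a..t, w s := by
    intro t ht
    rw [hpr.eq_add t ht, intervalIntegral.integral_of_le ht.1, intervalIntegral.integral_of_le ht.1,
      integral_Ioc_eq_integral_Ioo, integral_Ioc_eq_integral_Ioo]
    congr 1
    refine setIntegral_congr_ae measurableSet_Ioo ?_
    filter_upwards [hc] with s hs hm
    have hm' : s ∈ Ioo a b := ⟨hm.1, hm.2.trans_le ht.2⟩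
    rw [hs hm', hwe s (Ioo_subset_Icc_self hm')]
  refine ⟨w, hwc, fun t ht => ?_⟩
  have hd : HasDerivAt (fun t => x a + ∫ s in a..t, w s) (w t) t :=
    (intervalIntegral.integral_hasDerivAt_right (hwc.intervalIntegrable _ _)
      hwc.aestronglyMeasurable.stronglyMeasurableAtFilter hwc.continuousAt).const_add (x a)
  exact hd.hasDerivWithinAt.congr hxe (hxe t ht)

/-- Around each time without collision the loop is of class `C¹` (up to the endpoints). -/
theorem exists_Icc_hasDerivWithinAt (hT : 0 < T)
    (hU : ContDiff ℝ 1 (fun p : ℝ × Plane => U p.1 p.2)) (hx : x ∈ collisionLoops T)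
    (hmin : IsMinOn (action T U) (admissibleLoops T) x)
    (hne : ∀ᵐ t, t ∈ Icc 0 T → x t ≠ 0)
    (hP : IntegrableOn (fun t => 1 / ‖x t‖) (Icc 0 T)) {t : ℝ} (ht : t ∈ Icc 0 T)
    (hxt : x t ≠ 0) :
    ∃ a b, a < b ∧ t ∈ Icc a b ∧ Icc a b ⊆ Icc 0 T ∧ (∀ s ∈ Icc a b, x s ≠ 0) ∧
      ∃ w : ℝ → Plane, Continuous w ∧ ∀ s ∈ Icc a b, HasDerivWithinAt x (w s) (Icc 0 T) s := by
  have hev : ∀ᶠ s in nhdsWithin t (Icc 0 T), x s ≠ 0 := (hx.1.1 t ht).eventually_ne hxt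
  obtain ⟨r, hr, hball⟩ := Metric.mem_nhdsWithin_iff.1 hev
  have hIcc : ∀ ρ : ℝ, Icc (max 0 (t - ρ)) (min T (t + ρ)) = Icc 0 T ∩ Icc (t - ρ) (t + ρ) :=
    fun ρ => Icc_inter_Icc.symm
  have hlt : ∀ ρ : ℝ, 0 < ρ → max 0 (t - ρ) < min T (t + ρ) := fun ρ hρ => by
    rw [max_lt_iff, lt_min_iff, lt_min_iff]
    exact ⟨⟨hT, by linarith [ht.1]⟩, by linarith [ht.2], by linarith⟩
  have hxne : ∀ s ∈ Icc (max 0 (t - r / 2)) (min T (t + r / 2)), x s ≠ 0 := fun s hs => by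
    rw [hIcc] at hs
    refine hball ⟨?_, hs.1⟩
    rw [Metric.mem_ball, Real.dist_eq]
    refine lt_of_le_of_lt (b := r / 2) ?_ (by linarith)
    exact abs_le.2 ⟨by linarith [hs.2.1], by linarith [hs.2.2]⟩
  obtain ⟨w, hwc, hw⟩ := exists_continuous_hasDerivWithinAt hT hU hx hmin hne hP
    (by rw [hIcc]; exact inter_subset_left) (hlt (r / 2) (by linarith)) hxne
  -- On the smaller window, the larger one is a neighbourhood relative to `[0, T]`, so derivatives
  -- within it are derivatives within `[0, T]`.
  have hmono : Icc (max 0 (t - r / 4)) (min T (t + r / 4)) ⊆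
      Icc (max 0 (t - r / 2)) (min T (t + r / 2)) := by
    rw [hIcc, hIcc]
    exact inter_subset_inter_right _ (Icc_subset_Icc (by linarith) (by linarith))
  refine ⟨_, _, hlt (r / 4) (by linarith), ?_, ?_, fun s hs => hxne s (hmono hs), w, hwc,
    fun s hs => ?_⟩
  · rw [hIcc]
    exact ⟨ht, by linarith, by linarith⟩
  · rw [hIcc]
    exact inter_subset_left
  · have := hw s (hmono hs)
    rw [hIcc] at this hs
    rwa [hasDerivWithinAt_inter (Icc_mem_nhds (by linarith [hs.2.1]) (by linarith [hs.2.2]))] at this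

end Regularity

end ForcedKepler

theorem proposition3p1 (T : ℝ) (hT : 0 < T) (U : ℝ → ForcedKepler.Plane → ℝ)
    (hU : ContDiff ℝ 1 (fun p : ℝ × ForcedKepler.Plane => U p.1 p.2))
    (hper : ∀ (t : ℝ) (z : ForcedKepler.Plane), U (t + T) z = U t z)
    (C α : ℝ) (hC : 0 < C) (hα : α ∈ Set.Ioo (0 : ℝ) 2)
    (hgrowth : ∀ (t : ℝ) (z : ForcedKepler.Plane), |U t z| ≤ C * (1 + ‖z‖ ^ α))
    (x : ℝ → ForcedKepler.Plane) (hx : x ∈ ForcedKepler.collisionLoops T)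
    (hmin : IsMinOn (ForcedKepler.action T U) (ForcedKepler.admissibleLoops T) x) :
    -- the energy is well defined almost everywhere, and at every non-collision time
    MeasureTheory.volume {t ∈ Set.Icc 0 T | x t = 0} = 0 ∧
    (∀ t ∈ Set.Icc 0 T, x t ≠ 0 → DifferentiableWithinAt ℝ x (Set.Icc 0 T) t) ∧
    -- it belongs to `W^{1,1}(0,T)`, with the following distributional derivative
    ForcedKepler.MemSobolev T 1 (ForcedKepler.energy T x) ∧
    ForcedKepler.HasWeakDeriv T (ForcedKepler.energy T x)
      (fun t => inner ℝ (gradient (U t) (x t)) (ForcedKepler.velocity T x t)) ∧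
    -- it extends to a continuous function on `[0,T]`
    ∃ H : ℝ → ℝ, ContinuousOn H (Set.Icc 0 T) ∧
      ∀ t ∈ Set.Icc 0 T, x t ≠ 0 → H t = ForcedKepler.energy T x t := by
  have hfin : ForcedKepler.action T U x < ⊤ := by
    obtain ⟨y, hy, hyA⟩ := ForcedKepler.exists_admissible_action_lt_top hT U
    exact lt_of_le_of_lt (hmin hy) hyA
  obtain ⟨hne, hP⟩ := ForcedKepler.ae_ne_zero_of_action_lt_top hx.1.1 hfin
  obtain ⟨hE, hG, hw⟩ := ForcedKepler.hasWeakDeriv_energy hT hU hx hmin hne hP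
  have hreg := fun t (ht : t ∈ Icc 0 T) (hxt : x t ≠ 0) =>
    ForcedKepler.exists_Icc_hasDerivWithinAt hT hU hx hmin hne hP ht hxt
  refine ⟨?_, fun t ht hxt => ?_, ⟨memLp_one_iff_integrable.2 (hE.mono_set Ioo_subset_Icc_self),
    _, memLp_one_iff_integrable.2 (hG.mono_set Ioo_subset_Icc_self), hw⟩, hw, ?_⟩
  · rw [← nonpos_iff_eq_zero, ← ae_iff.1 hne]
    exact measure_mono fun t ht h => h ht.1 ht.2
  · obtain ⟨a, b, -, hab, -, -, w, -, hd⟩ := hreg t ht hxt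
    exact (hd t hab).differentiableWithinAt
  · obtain ⟨c, hc⟩ := ForcedKepler.exists_ae_eq_add_integral hT
      (hE.mono_set Ioo_subset_Icc_self) (hG.mono_set Ioo_subset_Icc_self)
      (fun φ h1 h2 h3 => hw.2.2 φ ⟨h1, h2, h3⟩)
    have hHc := ForcedKepler.IsPrimitive.continuousOn hT.le (f := fun t => c + ∫ s in 0..t,
      inner ℝ (gradient (U s) (x s)) (ForcedKepler.velocity T x s))
      ⟨(intervalIntegrable_iff_integrableOn_Icc_of_le hT.le).2 hG, by simp⟩
    refine ⟨_, hHc, fun t ht hxt => ?_⟩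
    obtain ⟨a, b, hab, htab, hsub, hxab, w, hwc, hd⟩ := hreg t ht hxt
    have hvel : ∀ s ∈ Icc a b, ForcedKepler.velocity T x s = w s := fun s hs =>
      (hd s hs).derivWithin (uniqueDiffOn_Icc hT s (hsub hs))
    have hEc : ContinuousOn (ForcedKepler.energy T x) (Icc a b) := by
      have : ContinuousOn (fun s => ‖w s‖ ^ 2 / 2 - 1 / ‖x s‖) (Icc a b) :=
        ((hwc.norm.pow 2).div_const 2).continuousOn.sub (continuousOn_const.div
          (hx.1.1.mono hsub).norm fun s hs => norm_ne_zero_iff.2 (hxab s hs))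
      refine this.congr fun s hs => ?_
      rw [ForcedKepler.energy, hvel s hs]
    -- Two continuous functions equal a.e. on a nondegenerate interval agree at each of its points,
    -- in particular at `t`.
    refine Measure.eqOn_Icc_of_ae_eq volume hab.ne ?_ (hHc.mono hsub) hEc htab
    rw [← Measure.restrict_congr_set (Ioo_ae_eq_Icc (a := a) (b := b)), Filter.EventuallyEq,
      ae_restrict_iff' measurableSet_Ioo]
    filter_upwards [hc] with s hs hm
    have ha := hsub (left_mem_Icc.2 hab.le)
    have hb := hsub (right_mem_Icc.2 hab.le)
    exact (hs ⟨ha.1.trans_lt hm.1, hm.2.trans_le hb.2⟩).symm
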